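/- Let $\mathbb S^n$ be the space of real symmetric $n\times n$ matrices with the inner product $\langle X,Y\rangle=\operatorname{tr}(XY)$ and the Frobenius norm $\|\cdot\|$, let $\mathbb S^n_+$ be its positive semidefinite cone and let $\Pi$ be the orthogonal projection onto that cone ($\Pi_{\mathbb S^{\beta}_+}$ for symmetric matrices indexed by a finite set $\beta$). Given $A_1,\dots,A_m,C\in\mathbb S^n$ and $b\in\mathbb R^m$, put $\mathcal A X=(\langle A_i,X\rangle)_{i=1}^m$, $\mathcal A^*y=\sum_i y_iA_i$, and consider the pair of semidefinite programs $$\min\{\langle C,X\rangle:\ \mathcal AX=b,\ X\in\mathbb S^n_+\},\qquad \max\{b^{\mathsf T}y:\ \mathcal A^*y+S=C,\ S\in\mathbb S^n_+\}.$$ Assume that $\mathcal A$ is surjective and that $(X_\star,y_\star,S_\star)$ is a KKT point: $\mathcal AX_\star=b$, $\mathcal A^*y_\star+S_\star=C$, $\langle X_\star,S_\star\rangle=0$, $X_\star,S_\star\in\mathbb S^n_+$. Let $\sigma>0$ and $Z_\star=X_\star-\sigma S_\star=Q\,\mathrm{diag}(\lambda_1,\dots,\lambda_n)\,Q^{\mathsf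 T}$ with $Q$ orthogonal, and let $\alpha=\{i:\lambda_i>0\}$, $\beta=\{i:\lambda_i=0\}$, $\gamma=\{i:\lambda_i<0\}$ (so the $\lambda_i$, $i\in\alpha$, are the positive eigenvalues of $X_\star$ and the $-\lambda_i$, $i\in\gamma$, are those of $\sigma S_\star$). Strict complementarity, i.e. $\beta=\emptyset$, is not assumed. Let $$\mathcal T_{X_\star}=\{H\in\mathbb S^n:(Q^{\mathsf T}HQ)_{ij}=0\ \text{for } i,j\notin\alpha\},\qquad \mathcal T_{S_\star}=\{H\in\mathbb S^n:(Q^{\mathsf T}HQ)_{ij}=0\ \text{for } i,j\notin\gamma\},$$ and assume primal nondegeneracy $\mathcal T_{X_\star}+\ker\mathcal A=\mathbb S^n$ and dual nondegeneracy $\mathcal T_{S_\star}+\operatorname{range}\mathcal A^*=\mathbb S^n$. For $H\in\mathbb S^n$ put $G=Q^{\mathsf T}HQ$ and let $$D(H)=Q\,\widetilde G\,Q^{\mathsf T},\qquad \widetilde G=\begin{pmatrix}G_{\alpha\alpha}&G_{\alpha\beta}&\widetilde\Theta^{\mathsf T}\circ G_{\alpha\gamma}\\ G_{\beta\alpha}&\Pi_{\mathbb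 S^{\beta}_+}(G_{\beta\beta})&0\\ \widetilde\Theta\circ G_{\gamma\alpha}&0&0\end{pmatrix},\qquad \widetilde\Theta_{ij}=\frac{\lambda_j}{\lambda_j-\lambda_i}\quad(i\in\gamma,\ j\in\alpha),$$ where $\circ$ is the entrywise product. Let $\mathcal P=\mathcal A^*(\mathcal A\mathcal A^*)^{-1}\mathcal A$ and $$\widetilde{\mathcal M}(H)=\mathcal P\,(H-D(H))+(\mathrm{Id}-\mathcal P)\,D(H),\qquad \rho_{\mathrm{ND}}=\sup_{\|H\|=1}\|\widetilde{\mathcal M}(H)\|.$$ (For $n=0$ the supremum over the empty set is read as $0$.) Then: 1. $D(H)$ is the directional derivative of $\Pi$ at $Z_\star$: $\lim_{t\downarrow0}t^{-1}(\Pi(Z_\star+tH)-\Pi(Z_\star))=D(H)$ for every $H\in\mathbb S^n$; and $\widetilde{\mathcal M}$ is positively homogeneous, $\widetilde{\mathcal M}(tH)=t\,\widetilde{\mathcal M}(H)$ for $t\ge0$. 2. The supremum is finite and $\rho_{\mathrm{ND}}<1$. 3. For every $Z^{(0)}\in\mathbb S^n$, the sequence generated by one-step ADMM, $$Z^{(k+1)}=\mathcal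 A^*(\mathcal A\mathcal A^*)^{-1}\mathcal A\bigl(-2\Pi(Z^{(k)})+Z^{(k)}\bigr)+\Pi(Z^{(k)})+\mathcal A^*(\mathcal A\mathcal A^*)^{-1}b+\sigma\mathcal A^*(\mathcal A\mathcal A^*)^{-1}\mathcal AC-\sigma C,$$ converges to $Z_\star$, and for every $\rho\in(\rho_{\mathrm{ND}},1)$ there is $\bar k\in\mathbb N$ such that $$\|Z^{(k+1)}-Z_\star\|\le\rho\,\|Z^{(k)}-Z_\star\|\qquad\text{for all integers }k\ge\bar k.$$ 4. The same holds for $Z^{(k)}=X^{(k)}-\sigma S^{(k)}$ whenever $(X^{(k)},y^{(k)},S^{(k)})$ is generated, from any starting point with $X^{(0)},S^{(0)}\in\mathbb S^n$, by three-step ADMM: $$\begin{aligned}y^{(k+1)}&=(\mathcal A\mathcal A^*)^{-1}\bigl(\sigma^{-1}b-\mathcal A(\sigma^{-1}X^{(k)}+S^{(k)}-C)\bigr),\\ S^{(k+1)}&=\Pi\bigl(C-\mathcal A^*y^{(k+1)}-\sigma^{-1}X^{(k)}\bigr),\\ X^{(k+1)}&=X^{(k)}+\sigma\bigl(S^{(k+1)}+\mathcal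 A^*y^{(k+1)}-C\bigr).\end{aligned}$$ -/

import Mathlib

open Filter Topology

namespace SDPADMM

/-! ### Symmetric matrices with the Frobenius inner product -/

/-- The symmetric elements of the Euclidean space of square arrays indexed by `ι`. -/
def symSubmodule (ι : Type) [Fintype ι] : Submodule ℝ (EuclideanSpace ℝ (ι × ι)) where
  carrier := {x | ∀ i j, x (i, j) = x (j, i)}
  add_mem' := by
    intro x y hx hy i j
    simp [hx i j, hy i j]
  zero_mem' := by
    intro i j
    simp
  smul_mem' := by
    intro c x hx i j
    simp [hx i j]

/-- Real symmetric matrices indexed by `ι`.  As a subspace of a Euclidean space this carries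
the inner product `⟪X, Y⟫ = ∑ i j, X i j * Y i j = trace (X * Y)` and the Frobenius norm
(see `inner_eq_trace`). -/
abbrev Sym (ι : Type) [Fintype ι] : Type := ↥(symSubmodule ι)

/-- The matrix of an element of `Sym ι`. -/
def toMat {ι : Type} [Fintype ι] (X : Sym ι) : Matrix ι ι ℝ :=
  Matrix.of fun i j => (X : EuclideanSpace ℝ (ι × ι)) (i, j)

/-- The element of `Sym ι` with a given symmetric matrix. -/
def ofMat {ι : Type} [Fintype ι] (M : Matrix ι ι ℝ) (hM : M.transpose = M) : Sym ι :=
  ⟨WithLp.toLp 2 fun p => M p.1 p.2, fun i j => congrFun (congrFun hM j) i⟩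

theorem toMat_ofMat {ι : Type} [Fintype ι] (M : Matrix ι ι ℝ) (hM : M.transpose = M) :
    toMat (ofMat M hM) = M := rfl

theorem toMat_transpose {ι : Type} [Fintype ι] (X : Sym ι) :
    (toMat X).transpose = toMat X := by
  ext i j
  exact X.2 j i

theorem inner_eq_trace {ι : Type} [Fintype ι] (X Y : Sym ι) :
    inner ℝ X Y = (toMat X * toMat Y).trace := by
  rw [Submodule.coe_inner, PiLp.inner_apply, Fintype.sum_prod_type]
  simp only [Matrix.trace, Matrix.diag, Matrix.mul_apply]
  refine Finset.sum_congr rfl fun i _ => Finset.sum_congr rfl fun j _ => ?_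
  change (Y : EuclideanSpace ℝ (ι × ι)) (i, j) * (X : EuclideanSpace ℝ (ι × ι)) (i, j) =
    (X : EuclideanSpace ℝ (ι × ι)) (i, j) * (Y : EuclideanSpace ℝ (ι × ι)) (j, i)
  rw [Y.2 j i, mul_comm]

/-! ### Metric projection onto the positive semidefinite cone -/

/-- The cone of positive semidefinite matrices. -/
def psdCone (ι : Type) [Fintype ι] : Set (Sym ι) := {X | (toMat X).PosSemidef}

theorem exists_nearest_psd {ι : Type} [Fintype ι] (Z : Sym ι) :
    ∃ X ∈ psdCone ι, ∀ Y ∈ psdCone ι, ‖Z - X‖ ≤ ‖Z - Y‖ := by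
  have hset : psdCone ι = ⋂ v : ι → ℝ, {X : Sym ι | 0 ≤ v ⬝ᵥ (toMat X).mulVec v} := by
    ext X
    simp only [psdCone, Set.mem_ofPred_eq, Set.mem_iInter]
    rw [Matrix.posSemidef_iff_dotProduct_mulVec]
    constructor
    · intro h v
      simpa using h.2 v
    · intro h
      refine ⟨?_, fun v => by simpa using h v⟩
      rw [Matrix.IsHermitian, Matrix.conjTranspose_eq_transpose_of_trivial]
      exact toMat_transpose X
  have hcl : IsClosed (psdCone ι) := by
    rw [hset]
    refine isClosed_iInter fun v => isClosed_le continuous_const ?_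
    simp only [dotProduct, Matrix.mulVec, toMat, Matrix.of_apply]
    fun_prop
  have hne : (psdCone ι).Nonempty := by
    refine ⟨0, ?_⟩
    have h0 : toMat (0 : Sym ι) = 0 := by
      ext i j
      rfl
    change (toMat (0 : Sym ι)).PosSemidef
    rw [h0]
    exact Matrix.PosSemidef.zero
  obtain ⟨X, hX, hd⟩ := hcl.exists_infDist_eq_dist hne Z
  refine ⟨X, hX, fun Y hY => ?_⟩
  rw [← dist_eq_norm, ← dist_eq_norm, ← hd]
  exact Metric.infDist_le_dist_of_mem hY

/-- The orthogonal (nearest-point) projection onto the positive semidefinite cone. -/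
noncomputable def psdProj {ι : Type} [Fintype ι] (Z : Sym ι) : Sym ι :=
  Classical.choose (exists_nearest_psd Z)

theorem psdProj_spec {ι : Type} [Fintype ι] (Z : Sym ι) :
    psdProj Z ∈ psdCone ι ∧ ∀ Y ∈ psdCone ι, ‖Z - psdProj Z‖ ≤ ‖Z - Y‖ :=
  Classical.choose_spec (exists_nearest_psd Z)

/-! ### The semidefinite program and ADMM -/

/-- `𝒜 X = (⟪A 1, X⟫, …, ⟪A m, X⟫)`. -/
noncomputable def opA {n m : ℕ} (A : Fin m → Sym (Fin n)) : Sym (Fin n) →ₗ[ℝ] (Fin m → ℝ) :=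
  LinearMap.pi fun i => innerₛₗ ℝ (A i)

/-- `𝒜* y = ∑ i, y i • A i`. -/
noncomputable def opAadj {n m : ℕ} (A : Fin m → Sym (Fin n)) :
    (Fin m → ℝ) →ₗ[ℝ] Sym (Fin n) :=
  Fintype.linearCombination ℝ A

/-- `(𝒜 𝒜*)⁻¹`, the inverse in the ring of endomorphisms of `ℝᵐ`
(`𝒜 𝒜*` is invertible whenever `𝒜` is surjective). -/
noncomputable def gramInv {n m : ℕ} (A : Fin m → Sym (Fin n)) : Module.End ℝ (Fin m → ℝ) :=
  Ring.inverse (opA A ∘ₗ opAadj A)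

/-- `𝒫 = 𝒜* (𝒜 𝒜*)⁻¹ 𝒜`. -/
noncomputable def projRange {n m : ℕ} (A : Fin m → Sym (Fin n)) :
    Sym (Fin n) →ₗ[ℝ] Sym (Fin n) :=
  opAadj A ∘ₗ gramInv A ∘ₗ opA A

/-- The Karush–Kuhn–Tucker conditions for
`min ⟪C, X⟫ s.t. 𝒜 X = b, X ⪰ 0` and `max bᵀ y s.t. 𝒜* y + S = C, S ⪰ 0`. -/
structure IsKKT {n m : ℕ} (A : Fin m → Sym (Fin n)) (b : Fin m → ℝ) (C : Sym (Fin n))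
    (X : Sym (Fin n)) (y : Fin m → ℝ) (S : Sym (Fin n)) : Prop where
  primal_feasible : opA A X = b
  dual_feasible : opAadj A y + S = C
  complementary : inner ℝ X S = 0
  primal_psd : X ∈ psdCone (Fin n)
  dual_psd : S ∈ psdCone (Fin n)

/-- Sequences generated by three-step ADMM with penalty parameter `σ`. -/
structure IsADMM {n m : ℕ} (A : Fin m → Sym (Fin n)) (b : Fin m → ℝ) (C : Sym (Fin n)) (σ : ℝ)
    (X : ℕ → Sym (Fin n)) (y : ℕ → Fin m → ℝ) (S : ℕ → Sym (Fin n)) : Prop where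
  y_step : ∀ k, y (k + 1) = gramInv A (σ⁻¹ • b - opA A (σ⁻¹ • X k + S k - C))
  S_step : ∀ k, S (k + 1) = psdProj (C - opAadj A (y (k + 1)) - σ⁻¹ • X k)
  X_step : ∀ k, X (k + 1) = X k + σ • (S (k + 1) + opAadj A (y (k + 1)) - C)

/-- One-step ADMM, the fixed-point map acting on `Z = X - σ S`. -/
noncomputable def oneStep {n m : ℕ} (A : Fin m → Sym (Fin n)) (b : Fin m → ℝ)
    (C : Sym (Fin n)) (σ : ℝ) (Z : Sym (Fin n)) : Sym (Fin n) :=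
  opAadj A (gramInv A (opA A (-(2 : ℝ) • psdProj Z + Z))) + psdProj Z
    + opAadj A (gramInv A b) + σ • opAadj A (gramInv A (opA A C)) - σ • C

/-! ### Nondegeneracy

Below, `Q` is orthogonal and `X⋆ - σ S⋆ = Q diag(lam) Qᵀ`, so that the positive eigenvalues `lam i`
are those of `X⋆` and the negative ones are those of `-σ S⋆`.  The index blocks are
`α = {lam > 0}`, `β = {lam = 0}`, `γ = {lam < 0}`. -/

/-- The congruence `H ↦ U H Uᵀ`. -/
noncomputable def conj {n : ℕ} (U : Matrix (Fin n) (Fin n) ℝ) (H : Sym (Fin n)) : Sym (Fin n) :=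
  ofMat (U * toMat H * U.transpose) (by
    rw [Matrix.transpose_mul, Matrix.transpose_mul, Matrix.transpose_transpose, toMat_transpose,
      Matrix.mul_assoc])

/-- `𝒯_{X⋆}`: the matrices `H` for which the block of `Qᵀ H Q` with rows and columns outside
`α` vanishes. -/
noncomputable def tangentX {n : ℕ} (Q : Matrix (Fin n) (Fin n) ℝ) (lam : Fin n → ℝ) :
    Submodule ℝ (Sym (Fin n)) where
  carrier := {H | ∀ i j, lam i ≤ 0 → lam j ≤ 0 → toMat (conj Q.transpose H) i j = 0}
  add_mem' := by
    intro H K hH hK i j hi hj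
    have hadd : toMat (H + K) = toMat H + toMat K := rfl
    have h1 := hH i j hi hj
    have h2 := hK i j hi hj
    simp only [conj, toMat_ofMat] at h1 h2 ⊢
    rw [hadd, Matrix.mul_add, Matrix.add_mul, Matrix.add_apply, h1, h2, add_zero]
  zero_mem' := by
    intro i j _ _
    have h0 : toMat (0 : Sym (Fin n)) = 0 := rfl
    simp [conj, toMat_ofMat, h0]
  smul_mem' := by
    intro c H hH i j hi hj
    have hsmul : toMat (c • H) = c • toMat H := rfl
    have h1 := hH i j hi hj
    simp only [conj, toMat_ofMat] at h1 ⊢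
    rw [hsmul, Matrix.mul_smul, Matrix.smul_mul, Matrix.smul_apply, h1, smul_zero]

/-- `𝒯_{S⋆}`: the matrices `H` for which the block of `Qᵀ H Q` with rows and columns outside
`γ` vanishes. -/
noncomputable def tangentS {n : ℕ} (Q : Matrix (Fin n) (Fin n) ℝ) (lam : Fin n → ℝ) :
    Submodule ℝ (Sym (Fin n)) := tangentX Q (-lam)

/-- Primal nondegeneracy: `𝒯_{X⋆} + 𝒩(𝒜) = 𝕊ⁿ`. -/
def PrimalNondegenerate {n m : ℕ} (A : Fin m → Sym (Fin n)) (Q : Matrix (Fin n) (Fin n) ℝ)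
    (lam : Fin n → ℝ) : Prop :=
  tangentX Q lam ⊔ LinearMap.ker (opA A) = ⊤

/-- Dual nondegeneracy: `𝒯_{S⋆} + ℛ(𝒜*) = 𝕊ⁿ`. -/
def DualNondegenerate {n m : ℕ} (A : Fin m → Sym (Fin n)) (Q : Matrix (Fin n) (Fin n) ℝ)
    (lam : Fin n → ℝ) : Prop :=
  tangentS Q lam ⊔ LinearMap.range (opAadj A) = ⊤

/-! ### The directional derivative of the projection and the operator `ℳ̃` -/

/-- The block `G_ββ`. -/
noncomputable def zeroBlock {n : ℕ} (lam : Fin n → ℝ) (G : Sym (Fin n)) :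
    Sym {i : Fin n // lam i = 0} :=
  ofMat ((toMat G).submatrix Subtype.val Subtype.val) (by
    rw [Matrix.transpose_submatrix, toMat_transpose])

open Classical in
/-- Entries of the directional derivative in the eigenbasis: with
`Θ̃ i j = lam j / (lam j - lam i)` for `i ∈ γ`, `j ∈ α`, the block matrix
`[G_αα, G_αβ, Θ̃ᵀ ∘ G_αγ; G_βα, Π(G_ββ), 0; Θ̃ ∘ G_γα, 0, 0]`. -/
noncomputable def derivEntry {n : ℕ} (lam : Fin n → ℝ) (G : Sym (Fin n)) (i j : Fin n) : ℝ :=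
  if h : lam i = 0 ∧ lam j = 0 then toMat (psdProj (zeroBlock lam G)) ⟨i, h.1⟩ ⟨j, h.2⟩
  else if 0 ≤ lam i ∧ 0 ≤ lam j then toMat G i j
  else if 0 < lam i ∧ lam j < 0 then lam i / (lam i - lam j) * toMat G i j
  else if lam i < 0 ∧ 0 < lam j then lam j / (lam j - lam i) * toMat G i j
  else 0

theorem derivEntry_symm {n : ℕ} (lam : Fin n → ℝ) (G : Sym (Fin n)) (i j : Fin n) :
    derivEntry lam G i j = derivEntry lam G j i := by
  have hG : toMat G i j = toMat G j i := congrFun (congrFun (toMat_transpose G) j) i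
  unfold derivEntry
  by_cases h : lam i = 0 ∧ lam j = 0
  · rw [dif_pos h, dif_pos h.symm]
    exact congrFun (congrFun (toMat_transpose (psdProj (zeroBlock lam G))) ⟨j, h.2⟩) ⟨i, h.1⟩
  · rw [dif_neg h, dif_neg (fun h' => h h'.symm), hG]
    split_ifs <;> first | rfl | (exfalso; grind)

/-- `D(H)`, the directional derivative at `Z⋆ = Q diag(lam) Qᵀ` of the projection onto the
positive semidefinite cone, in closed form. -/
noncomputable def dirDeriv {n : ℕ} (Q : Matrix (Fin n) (Fin n) ℝ) (lam : Fin n → ℝ)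
    (H : Sym (Fin n)) : Sym (Fin n) :=
  conj Q (ofMat (Matrix.of fun i j => derivEntry lam (conj Q.transpose H) i j) (by
    ext i j
    exact derivEntry_symm lam _ j i))

/-- `ℳ̃(H) = 𝒫 D⊥(H) + 𝒫⊥ D(H)`, where `D⊥(H) = H - D(H)` and `𝒫⊥ = Id - 𝒫`. -/
noncomputable def opM {n m : ℕ} (A : Fin m → Sym (Fin n)) (Q : Matrix (Fin n) (Fin n) ℝ)
    (lam : Fin n → ℝ) (H : Sym (Fin n)) : Sym (Fin n) :=
  projRange A (H - dirDeriv Q lam H) + (dirDeriv Q lam H - projRange A (dirDeriv Q lam H))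

/-- The values `‖ℳ̃(H)‖` for `‖H‖ = 1`. -/
def normValues {n m : ℕ} (A : Fin m → Sym (Fin n)) (Q : Matrix (Fin n) (Fin n) ℝ)
    (lam : Fin n → ℝ) : Set ℝ :=
  {c | ∃ H : Sym (Fin n), ‖H‖ = 1 ∧ c = ‖opM A Q lam H‖}

/-- `ρ_ND = sup {‖ℳ̃(H)‖ : ‖H‖ = 1}` (equal to `0` in the trivial case `n = 0`). -/
noncomputable def rhoND {n m : ℕ} (A : Fin m → Sym (Fin n)) (Q : Matrix (Fin n) (Fin n) ℝ)
    (lam : Fin n → ℝ) : ℝ :=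
  sSup (normValues A Q lam)

/-- Local Q-linear convergence of `Z` to `Zs` with every rate in `(ρ₀, 1)`. -/
def ConvergesQLinearly {n : ℕ} (Z : ℕ → Sym (Fin n)) (Zs : Sym (Fin n)) (ρ₀ : ℝ) : Prop :=
  Tendsto Z atTop (𝓝 Zs) ∧
    ∀ ρ : ℝ, ρ₀ < ρ → ρ < 1 →
      ∃ K : ℕ, ∀ k : ℕ, K ≤ k → ‖Z (k + 1) - Zs‖ ≤ ρ * ‖Z k - Zs‖

end SDPADMM

namespace SDPADMM

/-! ### Linear structure of symmetric matrices -/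

section Sym

variable {ι : Type} [Fintype ι]

/-! Up to a constant, one-step ADMM is `Z ↦ 𝒫(Z - Π Z) + (Id - 𝒫) Π Z`, where `𝒫` is the orthogonal
projection onto the range of `𝒜*`. Put `δ = W - Z` and `d = Π W - Π Z`. By orthogonality the images
of `W` and `Z` differ by a vector of squared norm `‖𝒫(δ - d)‖² + ‖(Id - 𝒫)d‖² ≤ ‖δ - d‖² + ‖d‖² =
‖δ‖² - 2⟪d, δ - d⟫`. Firm nonexpansiveness of `Π` makes the last term harmless, so the iteration is
nonexpansive (`norm_oneStep_sub_le`). The derivative `ℳ̃` has the same shape with `D(H)` in place of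
`d`, so `‖ℳ̃(H)‖ ≤ ‖H‖`. Equality forces `⟪D, H - D⟫ = 0`, `H - D ∈ range 𝒜*` and `D ∈ ker 𝒜`. The
first condition kills the block `G_γα`, after which `D ⊥ 𝒯_S` and `H - D ⊥ 𝒯_X`; the two
nondegeneracy conditions then give `D = 0` and `H - D = 0` (`eq_zero_of_norm_le_norm_opM`).
Compactness of the unit sphere yields `ρ_ND < 1`. The formula for `D` needs no eigenvalue
perturbation theory. To first order `Z⋆ + tH` is a difference of two positive semidefinite matrices
obtained by congruences that keep them complementary up to `O(t⁴)`, and such a difference nearly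
computes the projection (`norm_psdProj_sub_sq_le`). Finally, a nonexpansive map is approximated by
its directional derivatives uniformly in the direction, so the iteration contracts on a ball around
`Z⋆`. Outside that ball nonexpansiveness along the segment to `Z⋆` lowers the distance by a fixed
amount per step, so global convergence follows from the local rate (`convergence_of_dirDeriv`). -/

theorem toMat_injective : Function.Injective (toMat (ι := ι)) := by
  intro X Y h
  apply Subtype.ext
  ext p
  exact congrFun (congrFun h p.1) p.2

theorem toMat_add (X Y : Sym ι) : toMat (X + Y) = toMat X + toMat Y := rfl

theorem toMat_sub (X Y : Sym ι) : toMat (X - Y) = toMat X - toMat Y := rfl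

theorem toMat_smul (c : ℝ) (X : Sym ι) : toMat (c • X) = c • toMat X := rfl

theorem toMat_apply_comm (X : Sym ι) (i j : ι) : toMat X i j = toMat X j i := X.2 i j

theorem Sym.inner_smul_smul (c : ℝ) (X Y : Sym ι) :
    inner ℝ (c • X) (c • Y) = c * (c * inner ℝ X Y) :=
  (real_inner_smul_left X (c • Y) c).trans (congrArg (c * ·) (real_inner_smul_right X Y c))

theorem inner_eq_sum (X Y : Sym ι) :
    inner ℝ X Y = ∑ i, ∑ j, toMat X i j * toMat Y i j := by
  rw [inner_eq_trace]
  simp only [Matrix.trace, Matrix.diag, Matrix.mul_apply]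
  refine Finset.sum_congr rfl fun i _ => Finset.sum_congr rfl fun j _ => ?_
  rw [toMat_apply_comm Y]

open scoped MatrixOrder Matrix.Norms.L2Operator in
theorem exists_eq_conjTranspose_mul_self {X : Sym ι} (hX : X ∈ psdCone ι) :
    ∃ B : Matrix ι ι ℝ, toMat X = B.conjTranspose * B := by
  classical
  exact CStarAlgebra.nonneg_iff_eq_star_mul_self.mp (Matrix.PosSemidef.nonneg hX)

theorem inner_nonneg_of_psd {X Y : Sym ι} (hX : X ∈ psdCone ι) (hY : Y ∈ psdCone ι) :
    0 ≤ inner ℝ X Y := by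
  obtain ⟨B, hB⟩ := exists_eq_conjTranspose_mul_self hY
  rw [inner_eq_trace, hB, ← Matrix.mul_assoc, Matrix.trace_mul_comm, ← Matrix.mul_assoc]
  exact (Matrix.PosSemidef.mul_mul_conjTranspose_same hX B).trace_nonneg

/-- With `X = Aᴴ A` and `Y = Bᴴ B`, the inner product is the squared Frobenius norm of `A Bᴴ`, a
factor of `X Y`. -/
theorem mul_eq_zero_of_inner_eq_zero {X Y : Sym ι} (hX : X ∈ psdCone ι) (hY : Y ∈ psdCone ι)
    (h : inner ℝ X Y = 0) : toMat X * toMat Y = 0 := by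
  obtain ⟨A, hA⟩ := exists_eq_conjTranspose_mul_self hX
  obtain ⟨B, hB⟩ := exists_eq_conjTranspose_mul_self hY
  have h0 : ((A * B.conjTranspose).conjTranspose * (A * B.conjTranspose)).trace = 0 := by
    rw [← h, inner_eq_trace, hA, hB, Matrix.conjTranspose_mul, Matrix.conjTranspose_conjTranspose,
      Matrix.trace_mul_comm (A.conjTranspose * A), Matrix.mul_assoc B.conjTranspose,
      Matrix.trace_mul_comm B.conjTranspose]
    simp only [Matrix.mul_assoc]
  rw [Matrix.trace_conjTranspose_mul_self_eq_zero_iff] at h0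
  rw [hA, hB, Matrix.mul_assoc, ← Matrix.mul_assoc A, h0, Matrix.zero_mul, Matrix.mul_zero]

theorem psd_zero : (0 : Sym ι) ∈ psdCone ι := Matrix.PosSemidef.zero

theorem psd_add {X Y : Sym ι} (hX : X ∈ psdCone ι) (hY : Y ∈ psdCone ι) :
    X + Y ∈ psdCone ι := Matrix.PosSemidef.add hX hY

theorem psd_smul {c : ℝ} (hc : 0 ≤ c) {X : Sym ι} (hX : X ∈ psdCone ι) :
    c • X ∈ psdCone ι := Matrix.PosSemidef.smul hX hc

theorem convex_psdCone : Convex ℝ (psdCone ι) := by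
  intro X hX Y hY a b ha hb _
  exact psd_add (psd_smul ha hX) (psd_smul hb hY)

/-- Self-duality of the positive semidefinite cone. -/
theorem psd_of_inner_nonneg {X : Sym ι} (h : ∀ Y ∈ psdCone ι, 0 ≤ inner ℝ X Y) :
    X ∈ psdCone ι := by
  change (toMat X).PosSemidef
  rw [Matrix.posSemidef_iff_dotProduct_mulVec]
  refine ⟨?_, fun v => ?_⟩
  · rw [Matrix.IsHermitian, Matrix.conjTranspose_eq_transpose_of_trivial]
    exact toMat_transpose X
  · have hv : (Matrix.vecMulVec v v).PosSemidef := by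
      simpa using Matrix.posSemidef_vecMulVec_self_star v
    -- Testing against the rank-one matrix `v vᵀ` recovers the quadratic form at `v`.
    have := h (ofMat (Matrix.vecMulVec v v) (by rw [Matrix.transpose_vecMulVec])) hv
    rw [inner_eq_sum] at this
    refine this.trans_eq ?_
    simp only [toMat_ofMat, Matrix.vecMulVec_apply, dotProduct, Matrix.mulVec, Finset.mul_sum]
    refine Finset.sum_congr rfl fun i _ => Finset.sum_congr rfl fun j _ => ?_
    simp only [star_trivial]
    ring

/-! ### The projection onto the positive semidefinite cone -/

theorem psdProj_mem (Z : Sym ι) : psdProj Z ∈ psdCone ι := (psdProj_spec Z).1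

theorem inner_sub_nonpos_of_nearest {V : Type*} [NormedAddCommGroup V] [InnerProductSpace ℝ V]
    {K : Set V} (hK : Convex ℝ K) {z x : V} (hx : x ∈ K) (h : ∀ y ∈ K, ‖z - x‖ ≤ ‖z - y‖)
    {y : V} (hy : y ∈ K) : inner ℝ (z - x) (y - x) ≤ 0 := by
  refine (norm_eq_iInf_iff_real_inner_le_zero hK hx).1 ?_ y hy
  have : Nonempty K := ⟨⟨x, hx⟩⟩
  have hbdd : BddBelow (Set.range fun w : K => ‖z - (w : V)‖) :=
    ⟨0, by rintro _ ⟨w, rfl⟩; exact norm_nonneg _⟩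
  exact le_antisymm (le_ciInf fun w => h w.1 w.2) (ciInf_le hbdd (⟨x, hx⟩ : K))

theorem inner_sub_psdProj_le (Z : Sym ι) {Y : Sym ι} (hY : Y ∈ psdCone ι) :
    inner ℝ (Z - psdProj Z) (Y - psdProj Z) ≤ 0 :=
  @inner_sub_nonpos_of_nearest (Sym ι) _ _ (psdCone ι) convex_psdCone Z (psdProj Z)
    (psdProj_mem Z) (psdProj_spec Z).2 Y hY

/-- In a cone the variational inequality may be tested at both `0` and `2 Π Z`, which gives opposite
signs. -/
theorem inner_sub_psdProj_self (Z : Sym ι) : inner ℝ (Z - psdProj Z) (psdProj Z) = 0 := by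
  have h0 := inner_sub_psdProj_le Z psd_zero
  have h2 := inner_sub_psdProj_le Z (psd_add (psdProj_mem Z) (psdProj_mem Z))
  rw [zero_sub, inner_neg_right] at h0
  rw [add_sub_cancel_right] at h2
  linarith

theorem psdProj_sub_self_mem (Z : Sym ι) : psdProj Z - Z ∈ psdCone ι := by
  refine psd_of_inner_nonneg fun Y hY => ?_
  have h := inner_sub_psdProj_le Z (psd_add hY (psdProj_mem Z))
  rw [add_sub_cancel_right] at h
  rw [← neg_sub, inner_neg_left]
  linarith

/-- The projection is firmly nonexpansive. -/
theorem inner_psdProj_sub_nonneg (Z W : Sym ι) :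
    0 ≤ inner ℝ (psdProj Z - psdProj W) ((Z - W) - (psdProj Z - psdProj W)) := by
  have h1 := inner_sub_psdProj_le Z (psdProj_mem W)
  have h2 := inner_sub_psdProj_le W (psdProj_mem Z)
  have h3 : inner ℝ (psdProj Z - psdProj W) ((Z - W) - (psdProj Z - psdProj W)) =
      -inner ℝ (Z - psdProj Z) (psdProj W - psdProj Z)
        - inner ℝ (W - psdProj W) (psdProj Z - psdProj W) := by
    rw [← neg_sub (psdProj Z) (psdProj W), inner_neg_right, neg_neg, ← inner_sub_left,
      real_inner_comm]
    congr 1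
    abel
  linarith

theorem norm_le_of_inner_sub_nonneg {V : Type*} [NormedAddCommGroup V] [InnerProductSpace ℝ V]
    {u v : V} (h : 0 ≤ inner ℝ u (v - u)) : ‖u‖ ≤ ‖v‖ := by
  rw [inner_sub_right, real_inner_self_eq_norm_sq] at h
  nlinarith [real_inner_le_norm u v, norm_nonneg u, norm_nonneg v]

theorem norm_psdProj_sub_le (Z W : Sym ι) : ‖psdProj Z - psdProj W‖ ≤ ‖Z - W‖ :=
  norm_le_of_inner_sub_nonneg (inner_psdProj_sub_nonneg Z W)

/-- An almost complementary decomposition `X - Y` almost computes the projection. -/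
theorem norm_psdProj_sub_sq_le {X Y : Sym ι} (hX : X ∈ psdCone ι) (hY : Y ∈ psdCone ι) :
    ‖psdProj (X - Y) - X‖ ^ 2 ≤ inner ℝ X Y := by
  have h := inner_sub_psdProj_le (X - Y) hX
  have h1 := inner_nonneg_of_psd hY (psdProj_mem (X - Y))
  rw [show X - Y - psdProj (X - Y) = (X - psdProj (X - Y)) - Y by abel, inner_sub_left,
    real_inner_self_eq_norm_sq, inner_sub_right, real_inner_comm] at h
  rw [norm_sub_rev]
  linarith

/-- Uniqueness in Moreau's decomposition. Homogeneity of `Π`, its value at `-Z` and its orthogonal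
equivariance are all read off from this criterion. -/
theorem psdProj_sub_eq {X Y : Sym ι} (hX : X ∈ psdCone ι) (hY : Y ∈ psdCone ι)
    (h : inner ℝ X Y = 0) : psdProj (X - Y) = X := by
  have := norm_psdProj_sub_sq_le hX hY
  rw [h] at this
  rw [← sub_eq_zero, ← norm_eq_zero]
  exact pow_eq_zero_iff two_ne_zero |>.1 (le_antisymm this (sq_nonneg _))

theorem psdProj_smul {c : ℝ} (hc : 0 ≤ c) (Z : Sym ι) : psdProj (c • Z) = c • psdProj Z := by
  have h := psdProj_sub_eq (psd_smul hc (psdProj_mem Z)) (psd_smul hc (psdProj_sub_self_mem Z))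
    (by
      rw [Sym.inner_smul_smul, real_inner_comm, ← neg_sub, inner_neg_left,
        inner_sub_psdProj_self]
      simp)
  rwa [← smul_sub, sub_sub_cancel] at h

theorem psdProj_neg (Z : Sym ι) : psdProj (-Z) = psdProj Z - Z := by
  have h := psdProj_sub_eq (psdProj_sub_self_mem Z) (psdProj_mem Z)
    (by rw [← neg_sub, inner_neg_left, inner_sub_psdProj_self, neg_zero])
  rwa [sub_sub_cancel_left] at h

end Sym

/-! ### Orthogonal congruence -/

section Conj

variable {n : ℕ} {Q : Matrix (Fin n) (Fin n) ℝ}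

theorem toMat_conj (U : Matrix (Fin n) (Fin n) ℝ) (H : Sym (Fin n)) :
    toMat (conj U H) = U * toMat H * U.transpose := rfl

theorem conj_add (U : Matrix (Fin n) (Fin n) ℝ) (H K : Sym (Fin n)) :
    conj U (H + K) = conj U H + conj U K := by
  apply toMat_injective
  rw [toMat_add, toMat_conj, toMat_conj, toMat_conj, toMat_add, Matrix.mul_add, Matrix.add_mul]

theorem conj_smul (U : Matrix (Fin n) (Fin n) ℝ) (c : ℝ) (H : Sym (Fin n)) :
    conj U (c • H) = c • conj U H := by
  apply toMat_injective
  rw [toMat_smul, toMat_conj, toMat_conj, toMat_smul, Matrix.mul_smul, Matrix.smul_mul]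

theorem conj_sub (U : Matrix (Fin n) (Fin n) ℝ) (H K : Sym (Fin n)) :
    conj U (H - K) = conj U H - conj U K := by
  apply toMat_injective
  rw [toMat_sub, toMat_conj, toMat_conj, toMat_conj, toMat_sub, Matrix.mul_sub, Matrix.sub_mul]

theorem transpose_mul_self_of_mem (hQ : Q ∈ Matrix.orthogonalGroup (Fin n) ℝ) :
    Q.transpose * Q = 1 := (Matrix.mem_orthogonalGroup_iff' _ _).1 hQ

theorem mul_transpose_self_of_mem (hQ : Q ∈ Matrix.orthogonalGroup (Fin n) ℝ) :
    Q * Q.transpose = 1 := (Matrix.mem_orthogonalGroup_iff _ _).1 hQ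

theorem conj_transpose_conj (hQ : Q ∈ Matrix.orthogonalGroup (Fin n) ℝ) (H : Sym (Fin n)) :
    conj Q.transpose (conj Q H) = H := by
  apply toMat_injective
  have h := transpose_mul_self_of_mem hQ
  rw [toMat_conj, toMat_conj, Matrix.transpose_transpose]
  calc Q.transpose * (Q * toMat H * Q.transpose) * Q
      = (Q.transpose * Q) * toMat H * (Q.transpose * Q) := by simp only [Matrix.mul_assoc]
    _ = toMat H := by rw [h, Matrix.one_mul, Matrix.mul_one]

theorem conj_conj_transpose (hQ : Q ∈ Matrix.orthogonalGroup (Fin n) ℝ) (H : Sym (Fin n)) :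
    conj Q (conj Q.transpose H) = H := by
  apply toMat_injective
  have h := mul_transpose_self_of_mem hQ
  rw [toMat_conj, toMat_conj, Matrix.transpose_transpose]
  calc Q * (Q.transpose * toMat H * Q) * Q.transpose
      = (Q * Q.transpose) * toMat H * (Q * Q.transpose) := by simp only [Matrix.mul_assoc]
    _ = toMat H := by rw [h, Matrix.one_mul, Matrix.mul_one]

theorem inner_conj (hQ : Q ∈ Matrix.orthogonalGroup (Fin n) ℝ) (H K : Sym (Fin n)) :
    inner ℝ (conj Q H) (conj Q K) = inner ℝ H K := by
  have h := transpose_mul_self_of_mem hQ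
  rw [inner_eq_trace, inner_eq_trace, toMat_conj, toMat_conj]
  calc (Q * toMat H * Q.transpose * (Q * toMat K * Q.transpose)).trace
      = (Q * (toMat H * (Q.transpose * Q) * toMat K * Q.transpose)).trace := by
        simp only [Matrix.mul_assoc]
    _ = (toMat H * toMat K).trace := by
        rw [Matrix.trace_mul_comm, h, Matrix.mul_one, Matrix.mul_assoc, h, Matrix.mul_one]

theorem conj_psd (U : Matrix (Fin n) (Fin n) ℝ) {H : Sym (Fin n)} (hH : H ∈ psdCone (Fin n)) :
    conj U H ∈ psdCone (Fin n) := by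
  have := Matrix.PosSemidef.mul_mul_conjTranspose_same hH U
  rwa [Matrix.conjTranspose_eq_transpose_of_trivial] at this

theorem psdProj_conj (hQ : Q ∈ Matrix.orthogonalGroup (Fin n) ℝ) (Z : Sym (Fin n)) :
    psdProj (conj Q Z) = conj Q (psdProj Z) := by
  have h := psdProj_sub_eq (conj_psd Q (psdProj_mem Z)) (conj_psd Q (psdProj_sub_self_mem Z))
    (by rw [inner_conj hQ, real_inner_comm, ← neg_sub, inner_neg_left, inner_sub_psdProj_self,
      neg_zero])
  rwa [← conj_sub, sub_sub_cancel] at h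

theorem continuous_conj (U : Matrix (Fin n) (Fin n) ℝ) : Continuous (conj U) :=
  LinearMap.continuous_of_finiteDimensional
    ({ toFun := conj U, map_add' := conj_add U, map_smul' := conj_smul U } :
      Sym (Fin n) →ₗ[ℝ] Sym (Fin n))

end Conj

/-! ### Directional derivative of the projection at a diagonal matrix -/

theorem tendsto_inv_smul_sub_of_norm_le {V : Type*} [NormedAddCommGroup V] [NormedSpace ℝ V]
    {f : ℝ → V} {v d : V} {g : ℝ → ℝ} (hg : Continuous g)
    (h : ∀ t, 0 < t → ‖f t - v - t • d‖ ≤ t ^ 2 * g t) :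
    Tendsto (fun t : ℝ => t⁻¹ • (f t - v)) (𝓝[>] 0) (𝓝 d) := by
  rw [tendsto_iff_norm_sub_tendsto_zero]
  have hlim : Tendsto (fun t : ℝ => t * g t) (𝓝[>] 0) (𝓝 0) := by
    have : Tendsto (fun t : ℝ => t * g t) (𝓝 0) (𝓝 (0 * g 0)) :=
      (continuous_id.mul hg).tendsto 0
    rw [zero_mul] at this
    exact this.mono_left nhdsWithin_le_nhds
  refine tendsto_of_tendsto_of_tendsto_of_le_of_le' tendsto_const_nhds hlim
    (Eventually.of_forall fun _ => norm_nonneg _) ?_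
  filter_upwards [self_mem_nhdsWithin] with t ht
  have ht0 : (0 : ℝ) < t := ht
  have h1 : t⁻¹ • (f t - v) - d = t⁻¹ • (f t - v - t • d) := by
    rw [smul_sub _ (f t - v), inv_smul_smul₀ ht0.ne']
  rw [h1, norm_smul, norm_inv, Real.norm_of_nonneg ht0.le, inv_mul_le_iff₀ ht0]
  exact (h t ht0).trans_eq (by ring)

/-! ### Complementary pairs under an infinitesimal congruence -/

section Expansion

variable {n : ℕ}

/-- The first-order term of `(1 + t K) A (1 + t K)ᵀ` at `t = 0`. -/
def anticomm (K : Matrix (Fin n) (Fin n) ℝ) (A : Sym (Fin n)) : Sym (Fin n) :=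
  ofMat (K * toMat A + toMat A * K.transpose) (by
    rw [Matrix.transpose_add, Matrix.transpose_mul, Matrix.transpose_mul,
      Matrix.transpose_transpose, toMat_transpose, add_comm])

theorem conj_one_add_smul (K : Matrix (Fin n) (Fin n) ℝ) (A B : Sym (Fin n)) (t : ℝ) :
    conj (1 + t • K) (A + t • B) = A + t • (anticomm K A + B) +
      t ^ 2 • ((conj K A + anticomm K B) + t • conj K B) := by
  apply toMat_injective
  simp only [toMat_conj, toMat_add, toMat_smul, anticomm, toMat_ofMat, Matrix.transpose_add,
    Matrix.transpose_one, Matrix.transpose_smul, Matrix.mul_add, Matrix.add_mul, Matrix.one_mul,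
    Matrix.mul_one, Matrix.mul_smul, Matrix.smul_mul, smul_add, smul_smul]
  module

/-- The second congruence is the inverse transpose of the first to first order: `(1 - tK)(1 + tK) =
1 - t²K²`. Of the four resulting terms, three contain `A B` or, after cycling the trace, `B A`; only
the `t⁴` term survives. -/
theorem inner_conj_one_add_smul (K : Matrix (Fin n) (Fin n) ℝ) {A B : Sym (Fin n)} (t : ℝ)
    (hAB : toMat A * toMat B = 0) :
    inner ℝ (conj (1 + t • K) A) (conj (1 + t • -K.transpose) B) =
      t ^ 4 * (toMat A * (K * K).transpose * toMat B * (K * K)).trace := by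
  have hBA : toMat B * toMat A = 0 := by
    rw [← Matrix.transpose_eq_zero, Matrix.transpose_mul, toMat_transpose, toMat_transpose, hAB]
  have hN : (1 + t • -K) * (1 + t • K) = 1 - t ^ 2 • (K * K) := by
    simp only [Matrix.mul_add, Matrix.add_mul, Matrix.one_mul, Matrix.mul_one, Matrix.mul_smul,
      Matrix.smul_mul, Matrix.neg_mul]
    module
  have hN' : (1 + t • K).transpose * (1 + t • -K.transpose) =
      1 - t ^ 2 • (K * K).transpose := by
    rw [← Matrix.transpose_inj, ← Matrix.transpose_smul]
    simpa using hN
  rw [inner_eq_trace, toMat_conj, toMat_conj]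
  calc _ = ((1 + t • K) * (toMat A * ((1 + t • K).transpose * (1 + t • -K.transpose)) * toMat B *
        (1 + t • -K.transpose).transpose)).trace := by simp only [Matrix.mul_assoc]
    _ = (toMat A * (1 - t ^ 2 • (K * K).transpose) * toMat B *
        ((1 + t • -K) * (1 + t • K))).trace := by
        rw [Matrix.trace_mul_comm, hN']
        simp [Matrix.mul_assoc]
    _ = (toMat A * toMat B * (1 - t ^ 2 • (K * K)) -
        t ^ 2 • (toMat A * (K * K).transpose * toMat B) +
        t ^ 4 • (toMat A * (K * K).transpose * toMat B * (K * K))).trace := by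
        rw [hN]
        congr 1
        simp only [Matrix.mul_sub, Matrix.sub_mul, Matrix.mul_one, Matrix.mul_smul,
          Matrix.smul_mul]
        module
    _ = _ := by
        rw [hAB, Matrix.zero_mul, zero_sub, Matrix.trace_add, Matrix.trace_neg,
          Matrix.trace_smul, Matrix.trace_mul_comm, ← Matrix.mul_assoc, hBA, Matrix.zero_mul,
          Matrix.trace_zero, Matrix.trace_smul]
        simp

theorem continuous_toMat {ι : Type} [Fintype ι] : Continuous (toMat (ι := ι)) := by
  refine continuous_matrix fun i j => ?_
  simp only [toMat, Matrix.of_apply]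
  fun_prop

/-- A decomposition of a point and of a direction into complementary positive semidefinite parts,
twisted by an infinitesimal congruence, yields a directional derivative of the projection. -/
theorem tendsto_psdProj_of_decomposition (K : Matrix (Fin n) (Fin n) ℝ) {A B E F : Sym (Fin n)}
    (hA : A ∈ psdCone (Fin n)) (hB : B ∈ psdCone (Fin n)) (hE : E ∈ psdCone (Fin n))
    (hF : F ∈ psdCone (Fin n)) (hAB : toMat A * toMat B = 0) (hAF : toMat A * toMat F = 0)
    (hEB : toMat E * toMat B = 0) (hEF : toMat E * toMat F = 0) :
    Tendsto
      (fun t : ℝ => t⁻¹ • (psdProj (A - B + t • (anticomm K A + E - (anticomm (-K.transpose) B + F)))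
        - psdProj (A - B)))
      (𝓝[>] 0) (𝓝 (anticomm K A + E)) := by
  have hPi : psdProj (A - B) = A :=
    psdProj_sub_eq hA hB (by rw [inner_eq_trace, hAB, Matrix.trace_zero])
  rw [hPi]
  set R : ℝ → Sym (Fin n) := fun t => (conj K A + anticomm K E) + t • conj K E with hR
  set R' : ℝ → Sym (Fin n) := fun t =>
    (conj (-K.transpose) B + anticomm (-K.transpose) F) + t • conj (-K.transpose) F with hR'
  set c : ℝ → ℝ := fun t =>
    (toMat (A + t • E) * (K * K).transpose * toMat (B + t • F) * (K * K)).trace with hc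
  have hRc : Continuous R := by fun_prop
  have hRc' : Continuous R' := by fun_prop
  have hcc : Continuous c := by
    have h1 : Continuous fun t : ℝ => toMat (A + t • E) := continuous_toMat.comp (by fun_prop)
    have h2 : Continuous fun t : ℝ => toMat (B + t • F) := continuous_toMat.comp (by fun_prop)
    exact (((h1.matrix_mul continuous_const).matrix_mul h2).matrix_mul
      continuous_const).matrix_trace
  refine tendsto_inv_smul_sub_of_norm_le
    (g := fun t => ‖R t - R' t‖ + Real.sqrt (c t) + ‖R t‖) (by fun_prop) fun t ht => ?_
  set X := conj (1 + t • K) (A + t • E) with hX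
  set Y := conj (1 + t • -K.transpose) (B + t • F) with hY
  set D := anticomm K A + E
  set D' := anticomm (-K.transpose) B + F
  have hXe : X = A + t • D + t ^ 2 • R t := conj_one_add_smul K A E t
  have hYe : Y = B + t • D' + t ^ 2 • R' t := conj_one_add_smul _ B F t
  have hXp : X ∈ psdCone (Fin n) := conj_psd _ (psd_add hA (psd_smul ht.le hE))
  have hYp : Y ∈ psdCone (Fin n) := conj_psd _ (psd_add hB (psd_smul ht.le hF))
  have hXY : inner ℝ X Y = t ^ 4 * c t := by
    refine inner_conj_one_add_smul K t ?_
    rw [toMat_add, toMat_add, toMat_smul, toMat_smul]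
    simp [Matrix.mul_add, Matrix.add_mul, hAB, hAF, hEB, hEF]
  have hn : ∀ v : Sym (Fin n), ‖t ^ 2 • v‖ = t ^ 2 * ‖v‖ := fun v => by
    rw [norm_smul, Real.norm_of_nonneg (by positivity)]
  -- The true point and `X - Y` agree to first order, and `Π` is nonexpansive.
  have h1 : ‖psdProj (A - B + t • (D - D')) - psdProj (X - Y)‖ ≤ t ^ 2 * ‖R t - R' t‖ := by
    refine (norm_psdProj_sub_le _ _).trans_eq ?_
    rw [← hn, ← norm_neg, hXe, hYe]
    congr 1
    module
  -- The squared error is at most `⟪X, Y⟫ = t⁴ c(t)`, so the error itself is of order `t²`.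
  have h2 : ‖psdProj (X - Y) - X‖ ≤ t ^ 2 * Real.sqrt (c t) := by
    have h := norm_psdProj_sub_sq_le hXp hYp
    rw [hXY] at h
    have h' := Real.le_sqrt_of_sq_le h
    rwa [Real.sqrt_mul (by positivity), show t ^ 4 = (t ^ 2) ^ 2 by ring,
      Real.sqrt_sq (by positivity)] at h'
  have h3 : X - A - t • D = t ^ 2 • R t := by
    rw [hXe]
    module
  have h4 : psdProj (A - B + t • (D - D')) - A - t • D =
      (psdProj (A - B + t • (D - D')) - psdProj (X - Y)) + (psdProj (X - Y) - X)
        + t ^ 2 • R t := by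
    rw [← h3]
    abel
  rw [h4, mul_add, mul_add, ← hn (R t)]
  exact (norm_add₃_le).trans (by gcongr)

end Expansion

/-! ### The block formula for the derivative -/

section Diagonal

variable {n : ℕ}

/-- The diagonal matrix with given diagonal. -/
def diagSym (d : Fin n → ℝ) : Sym (Fin n) :=
  ofMat (Matrix.diagonal d) (Matrix.diagonal_transpose d)

theorem diagSym_psd {d : Fin n → ℝ} (hd : 0 ≤ d) : diagSym d ∈ psdCone (Fin n) :=
  Matrix.PosSemidef.diagonal hd

open Classical in
/-- Extension of a matrix indexed by the zeros of `lam` by zero. -/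
noncomputable def extendZeroBlock (lam : Fin n → ℝ) (B : Sym {i : Fin n // lam i = 0}) :
    Sym (Fin n) :=
  ofMat (Matrix.of fun i j =>
    if h : lam i = 0 ∧ lam j = 0 then toMat B ⟨i, h.1⟩ ⟨j, h.2⟩ else 0) (by
    ext i j
    simp only [Matrix.transpose_apply, Matrix.of_apply]
    by_cases h : lam i = 0 ∧ lam j = 0
    · rw [dif_pos h, dif_pos h.symm, toMat_apply_comm]
    · rw [dif_neg h, dif_neg (fun h' => h h'.symm)])

theorem sum_subtype_eq_sum_dite {ι M : Type*} [Fintype ι] [AddCommMonoid M] (p : ι → Prop)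
    [DecidablePred p] (f : {i // p i} → M) :
    ∑ a, f a = ∑ i, if h : p i then f ⟨i, h⟩ else 0 := by
  have h := Finset.sum_subtype (p := p) (F := inferInstance) (Finset.univ.filter p) (by simp)
    (f := fun i => if h : p i then f ⟨i, h⟩ else 0)
  rw [Finset.sum_filter] at h
  refine (Finset.sum_congr rfl fun a _ => ?_).trans (h.symm.trans
    (Finset.sum_congr rfl fun i _ => ?_))
  · rw [dif_pos a.2]
  · split_ifs <;> rfl

/-- Extension by zero is adjoint to restriction to the block `ββ`; with self-duality of the cone
this shows that extension preserves positive semidefiniteness. -/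
theorem inner_extendZeroBlock (lam : Fin n → ℝ) (B : Sym {i : Fin n // lam i = 0})
    (Y : Sym (Fin n)) : inner ℝ (extendZeroBlock lam B) Y = inner ℝ B (zeroBlock lam Y) := by
  classical
  rw [inner_eq_sum, inner_eq_sum, sum_subtype_eq_sum_dite]
  refine Finset.sum_congr rfl fun i _ => ?_
  by_cases hi : lam i = 0
  · rw [dif_pos hi, sum_subtype_eq_sum_dite]
    refine Finset.sum_congr rfl fun j _ => ?_
    by_cases hj : lam j = 0 <;> simp [extendZeroBlock, zeroBlock, toMat_ofMat, hi, hj]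
  · simp [extendZeroBlock, toMat_ofMat, hi]

theorem extendZeroBlock_psd (lam : Fin n → ℝ) {B : Sym {i : Fin n // lam i = 0}}
    (hB : B ∈ psdCone _) : extendZeroBlock lam B ∈ psdCone (Fin n) := by
  refine psd_of_inner_nonneg fun Y hY => ?_
  rw [inner_extendZeroBlock]
  exact inner_nonneg_of_psd hB (Matrix.PosSemidef.submatrix hY _)

theorem zeroBlock_extendZeroBlock (lam : Fin n → ℝ) (B : Sym {i : Fin n // lam i = 0}) :
    zeroBlock lam (extendZeroBlock lam B) = B := by
  apply toMat_injective
  ext i j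
  simp [zeroBlock, extendZeroBlock, toMat_ofMat, i.2, j.2]

/-- The generator of the congruence that block-diagonalizes `diag(lam) + t G` to first order. -/
noncomputable def rotGen (lam : Fin n → ℝ) (G : Sym (Fin n)) : Matrix (Fin n) (Fin n) ℝ :=
  Matrix.of fun i j => toMat G i j *
    (if 0 < lam j then (if 0 < lam i then (2 * lam j)⁻¹ else (lam j - lam i)⁻¹)
    else if lam i < 0 then (if lam j < 0 then -(2 * lam i)⁻¹ else -(lam i)⁻¹) else 0)

/-- The derivative of the projection at `diag(lam)` in the direction `G`. -/
noncomputable def blockDeriv (lam : Fin n → ℝ) (G : Sym (Fin n)) : Sym (Fin n) :=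
  ofMat (Matrix.of fun i j => derivEntry lam G i j) (by
    ext i j
    exact derivEntry_symm lam _ j i)

/-- Bundles every sign fact that `simp` needs to decide the conditionals in `rotGen` and
`derivEntry`. -/
theorem sign_cases (x : ℝ) :
    (x < 0 ∧ x ≠ 0 ∧ ¬0 < x ∧ ¬0 ≤ x ∧ max x 0 = 0 ∧ max (-x) 0 = -x) ∨
    (x = 0 ∧ ¬x < 0 ∧ ¬0 < x ∧ 0 ≤ x ∧ max x 0 = 0 ∧ max (-x) 0 = 0) ∨
    (0 < x ∧ x ≠ 0 ∧ ¬x < 0 ∧ 0 ≤ x ∧ max x 0 = x ∧ max (-x) 0 = 0) := by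
  rcases lt_trichotomy x 0 with h | h | h
  · exact Or.inl ⟨h, h.ne, h.not_gt, h.not_ge, max_eq_right h.le, max_eq_left (by linarith)⟩
  · subst h
    simp
  · exact Or.inr (Or.inr ⟨h, h.ne', h.not_gt, h.le, max_eq_left h.le, max_eq_right (by linarith)⟩)

/-- The generator is chosen so that this identity and its negative counterpart hold together: a
column weight `λ_j⁺` must reproduce `D`, and a row weight `λ_i⁻` must reproduce `D - G`. The
diagonal sign blocks need the factor `1/2` because both summands of `anticomm` contribute there. -/
theorem anticomm_rotGen_pos (lam : Fin n → ℝ) (G : Sym (Fin n)) :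
    anticomm (rotGen lam G) (diagSym fun i => max (lam i) 0)
      + extendZeroBlock lam (psdProj (zeroBlock lam G)) = blockDeriv lam G := by
  apply toMat_injective
  ext i j
  have hG := toMat_apply_comm G j i
  simp only [toMat_add, anticomm, toMat_ofMat, diagSym, extendZeroBlock, blockDeriv, rotGen,
    Matrix.add_apply, Matrix.mul_diagonal, Matrix.diagonal_mul, Matrix.transpose_apply,
    Matrix.of_apply, derivEntry, hG]
  rcases sign_cases (lam i) with ⟨hi, hi1, hi2, hi3, hi4, hi5⟩ | ⟨hi, hi1, hi2, hi3, hi4, hi5⟩ |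
    ⟨hi, hi1, hi2, hi3, hi4, hi5⟩ <;>
  rcases sign_cases (lam j) with ⟨hj, hj1, hj2, hj3, hj4, hj5⟩ | ⟨hj, hj1, hj2, hj3, hj4, hj5⟩ |
    ⟨hj, hj1, hj2, hj3, hj4, hj5⟩ <;>
  simp only [hi, hi1, hi2, hi3, hi4, hj, hj1, hj2, hj3, hj4, if_true, if_false,
    and_true, and_false, dite_true, dite_false, and_self, lt_self_iff_false, max_self,
    le_refl, sub_zero]
  all_goals first
    | (have hd := sub_ne_zero.2 (hi.trans hj).ne'
       field_simp; ring)
    | (have hd := sub_ne_zero.2 (hj.trans hi).ne'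
       field_simp; ring)
    | (field_simp; ring)

theorem anticomm_rotGen_neg (lam : Fin n → ℝ) (G : Sym (Fin n)) :
    anticomm (-(rotGen lam G).transpose) (diagSym fun i => max (-lam i) 0)
      + extendZeroBlock lam (psdProj (zeroBlock lam G) - zeroBlock lam G) =
        blockDeriv lam G - G := by
  apply toMat_injective
  ext i j
  have hG := toMat_apply_comm G j i
  simp only [toMat_add, toMat_sub, anticomm, toMat_ofMat, diagSym, extendZeroBlock, blockDeriv,
    rotGen, Matrix.add_apply, Matrix.sub_apply, Matrix.mul_diagonal, Matrix.diagonal_mul,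
    Matrix.transpose_apply, Matrix.neg_apply, Matrix.transpose_neg, zeroBlock,
    Matrix.submatrix_apply,
    Matrix.of_apply, derivEntry, hG]
  rcases sign_cases (lam i) with ⟨hi, hi1, hi2, hi3, hi4, hi5⟩ | ⟨hi, hi1, hi2, hi3, hi4, hi5⟩ |
    ⟨hi, hi1, hi2, hi3, hi4, hi5⟩ <;>
  rcases sign_cases (lam j) with ⟨hj, hj1, hj2, hj3, hj4, hj5⟩ | ⟨hj, hj1, hj2, hj3, hj4, hj5⟩ |
    ⟨hj, hj1, hj2, hj3, hj4, hj5⟩ <;>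
  simp only [hi, hi1, hi2, hi3, hi5, hj, hj1, hj2, hj3, hj5, if_true, if_false,
    and_true, and_false, dite_true, dite_false, and_self, lt_self_iff_false, max_self,
    le_refl, neg_zero, sub_zero]
  all_goals first
    | (have hd := sub_ne_zero.2 (hi.trans hj).ne'
       field_simp; ring)
    | (have hd := sub_ne_zero.2 (hj.trans hi).ne'
       field_simp; ring)
    | (field_simp; ring)

theorem diagSym_mul_diagSym {p q : Fin n → ℝ} (h : ∀ i, p i * q i = 0) :
    toMat (diagSym p) * toMat (diagSym q) = 0 := by
  simp [diagSym, toMat_ofMat, h]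

theorem diagSym_mul_extendZeroBlock {lam p : Fin n → ℝ} (h : ∀ i, lam i = 0 → p i = 0)
    (B : Sym {i : Fin n // lam i = 0}) : toMat (diagSym p) * toMat (extendZeroBlock lam B) = 0 := by
  ext i j
  simp only [diagSym, toMat_ofMat, Matrix.diagonal_mul, extendZeroBlock, Matrix.of_apply,
    Matrix.zero_apply]
  by_cases hi : lam i = 0
  · rw [h i hi, zero_mul]
  · rw [dif_neg (fun h' => hi h'.1), mul_zero]

theorem extendZeroBlock_mul_diagSym {lam p : Fin n → ℝ} (h : ∀ i, lam i = 0 → p i = 0)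
    (B : Sym {i : Fin n // lam i = 0}) : toMat (extendZeroBlock lam B) * toMat (diagSym p) = 0 := by
  rw [← Matrix.transpose_eq_zero, Matrix.transpose_mul, toMat_transpose, toMat_transpose,
    diagSym_mul_extendZeroBlock h]

/-- The decomposition uses `λ = λ⁺ - λ⁻` for the point and the Moreau parts of `G_ββ` for what the
congruence cannot produce, since both `λ⁺` and `λ⁻` vanish on `β`. -/
theorem tendsto_psdProj_diagSym (lam : Fin n → ℝ) (G : Sym (Fin n)) :
    Tendsto (fun t : ℝ => t⁻¹ • (psdProj (diagSym lam + t • G) - psdProj (diagSym lam)))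
      (𝓝[>] 0) (𝓝 (blockDeriv lam G)) := by
  set B := zeroBlock lam G
  have hp : diagSym (fun i => max (lam i) 0) ∈ psdCone (Fin n) :=
    diagSym_psd fun i => le_max_right _ _
  have hq : diagSym (fun i => max (-lam i) 0) ∈ psdCone (Fin n) :=
    diagSym_psd fun i => le_max_right _ _
  have hE : extendZeroBlock lam (psdProj B) ∈ psdCone (Fin n) :=
    extendZeroBlock_psd lam (psdProj_mem B)
  have hF : extendZeroBlock lam (psdProj B - B) ∈ psdCone (Fin n) :=
    extendZeroBlock_psd lam (psdProj_sub_self_mem B)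
  have hEF : inner ℝ (extendZeroBlock lam (psdProj B)) (extendZeroBlock lam (psdProj B - B)) =
      0 := by
    rw [inner_extendZeroBlock, zeroBlock_extendZeroBlock, ← neg_sub, inner_neg_right,
      real_inner_comm, inner_sub_psdProj_self, neg_zero]
  have hlam : diagSym lam = diagSym (fun i => max (lam i) 0) - diagSym fun i => max (-lam i) 0 := by
    apply toMat_injective
    rw [toMat_sub, diagSym, diagSym, diagSym, toMat_ofMat, toMat_ofMat, toMat_ofMat,
      Matrix.diagonal_sub]
    congr 1
    ext i
    rcases sign_cases (lam i) with h | h | h <;> linarith [h.2.2.2.2.1, h.2.2.2.2.2, h.1]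
  have h := tendsto_psdProj_of_decomposition (rotGen lam G) hp hq hE hF
    (diagSym_mul_diagSym fun i => by
      rcases sign_cases (lam i) with h | h | h <;> rw [h.2.2.2.2.1, h.2.2.2.2.2] <;> simp)
    (diagSym_mul_extendZeroBlock (fun i hi => by simp [hi]) _)
    (extendZeroBlock_mul_diagSym (fun i hi => by simp [hi]) _)
    (mul_eq_zero_of_inner_eq_zero hE hF hEF)
  rwa [anticomm_rotGen_pos, anticomm_rotGen_neg, sub_sub_cancel, ← hlam] at h

theorem dirDeriv_eq (Q : Matrix (Fin n) (Fin n) ℝ) (lam : Fin n → ℝ) (H : Sym (Fin n)) :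
    dirDeriv Q lam H = conj Q (blockDeriv lam (conj Q.transpose H)) := rfl

theorem eq_conj_diagSym {Q : Matrix (Fin n) (Fin n) ℝ} {lam : Fin n → ℝ} {Z : Sym (Fin n)}
    (hZ : toMat Z = Q * Matrix.diagonal lam * Q.transpose) : Z = conj Q (diagSym lam) :=
  toMat_injective hZ

theorem tendsto_psdProj_dirDeriv {Q : Matrix (Fin n) (Fin n) ℝ}
    (hQ : Q ∈ Matrix.orthogonalGroup (Fin n) ℝ) {lam : Fin n → ℝ} {Z : Sym (Fin n)}
    (hZ : toMat Z = Q * Matrix.diagonal lam * Q.transpose) (H : Sym (Fin n)) :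
    Tendsto (fun t : ℝ => t⁻¹ • (psdProj (Z + t • H) - psdProj Z)) (𝓝[>] 0)
      (𝓝 (dirDeriv Q lam H)) := by
  rw [dirDeriv_eq]
  refine (((continuous_conj Q).tendsto _).comp
    (tendsto_psdProj_diagSym lam (conj Q.transpose H))).congr fun t => ?_
  rw [Function.comp_apply, conj_smul, conj_sub, ← psdProj_conj hQ, ← psdProj_conj hQ, conj_add,
    conj_smul, conj_conj_transpose hQ, ← eq_conj_diagSym hZ]

end Diagonal

/-! ### Local and global convergence of nonexpansive iterations -/

section Nonexpansive

variable {V : Type*} [NormedAddCommGroup V] [NormedSpace ℝ V]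

/-- Difference quotients in two directions inherit the Lipschitz bound, and it survives the limit.
Continuity of `ℳ̃` also comes from here. -/
theorem norm_dirDeriv_sub_le {f M : V → V} {z : V} (hf : ∀ x y, ‖f x - f y‖ ≤ ‖x - y‖)
    (hM : ∀ h, Tendsto (fun t : ℝ => t⁻¹ • (f (z + t • h) - f z)) (𝓝[>] 0) (𝓝 (M h)))
    (x y : V) : ‖M x - M y‖ ≤ ‖x - y‖ := by
  refine le_of_tendsto ((hM x).sub (hM y)).norm ?_
  filter_upwards [self_mem_nhdsWithin] with t ht
  have ht0 : (0 : ℝ) < t := ht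
  rw [← smul_sub, sub_sub_sub_cancel_right, norm_smul, norm_inv, Real.norm_of_nonneg ht0.le,
    inv_mul_le_iff₀ ht0]
  refine (hf _ _).trans_eq ?_
  rw [add_sub_add_left_eq_sub, ← smul_sub, norm_smul, Real.norm_of_nonneg ht0.le]

/-- A nonexpansive map with positively homogeneous directional derivatives on a proper space
is approximated by them uniformly in the direction. -/
theorem exists_norm_sub_dirDeriv_le [ProperSpace V] {f M : V → V} {z : V}
    (hf : ∀ x y, ‖f x - f y‖ ≤ ‖x - y‖)
    (hM : ∀ h, Tendsto (fun t : ℝ => t⁻¹ • (f (z + t • h) - f z)) (𝓝[>] 0) (𝓝 (M h)))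
    (hhom : ∀ (t : ℝ) (h : V), 0 ≤ t → M (t • h) = t • M h) {ε : ℝ} (hε : 0 < ε) :
    ∃ r > 0, ∀ h, ‖h‖ ≤ r → ‖f (z + h) - f z - M h‖ ≤ ε * ‖h‖ := by
  -- A finite `ε/3`-net of directions: the limits are uniform over the net, and the Lipschitz bounds
  -- on `f` and `M` each cost another `ε/3` for the remaining directions.
  obtain ⟨s, hs, hfin, hcov⟩ :=
    (isCompact_sphere (0 : V) 1).finite_cover_balls (e := ε / 3) (by positivity)
  have hev : ∀ᶠ t : ℝ in 𝓝[>] 0, ∀ u ∈ s, ‖t⁻¹ • (f (z + t • u) - f z) - M u‖ < ε / 3 := by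
    refine (hfin.eventually_all).2 fun u _ => ?_
    have := (tendsto_iff_norm_sub_tendsto_zero.1 (hM u)).eventually_lt_const
      (show (0 : ℝ) < ε / 3 by positivity)
    exact this
  obtain ⟨r, hr, hrs⟩ := mem_nhdsGT_iff_exists_Ioc_subset.1 hev
  refine ⟨r, hr, fun h hh => ?_⟩
  by_cases h0 : h = 0
  · have hM0 : M 0 = 0 := by simpa using hhom 0 0 le_rfl
    simp [h0, hM0]
  have ht : 0 < ‖h‖ := norm_pos_iff.2 h0
  set t := ‖h‖ with ht_def
  set v := t⁻¹ • h with hv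
  have htv : t • v = h := smul_inv_smul₀ ht.ne' h
  have hv1 : v ∈ Metric.sphere (0 : V) 1 := by
    rw [mem_sphere_zero_iff_norm, hv, norm_smul, norm_inv, norm_norm, ← ht_def,
      inv_mul_cancel₀ ht.ne']
  obtain ⟨u, hus, huv⟩ := Set.mem_iUnion₂.1 (hcov hv1)
  rw [Metric.mem_ball, dist_eq_norm] at huv
  have h1 : ‖f (z + t • v) - f (z + t • u)‖ ≤ t * (ε / 3) := by
    refine (hf _ _).trans ?_
    rw [add_sub_add_left_eq_sub, ← smul_sub, norm_smul, Real.norm_of_nonneg ht.le]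
    gcongr
  have h2 : ‖f (z + t • u) - f z - t • M u‖ ≤ t * (ε / 3) := by
    have h := hrs (show t ∈ Set.Ioc 0 r from ⟨ht, hh⟩) u hus
    have h' : f (z + t • u) - f z - t • M u = t • (t⁻¹ • (f (z + t • u) - f z) - M u) := by
      rw [smul_sub, smul_inv_smul₀ ht.ne']
    rw [h', norm_smul, Real.norm_of_nonneg ht.le]
    gcongr
  have h3 : ‖t • (M u - M v)‖ ≤ t * (ε / 3) := by
    rw [norm_smul, Real.norm_of_nonneg ht.le]
    gcongr
    refine (norm_dirDeriv_sub_le hf hM u v).trans ?_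
    rw [norm_sub_rev]
    exact huv.le
  have h4 : f (z + h) - f z - M h = (f (z + t • v) - f (z + t • u)) +
      (f (z + t • u) - f z - t • M u) + t • (M u - M v) := by
    rw [← htv, hhom t v ht.le, smul_sub]
    abel
  rw [h4]
  exact norm_add₃_le.trans (by linarith)

theorem exists_norm_sub_le_mul_of_dirDeriv [ProperSpace V] {f M : V → V} {z : V} {ρ₀ ρ : ℝ}
    (hf : ∀ x y, ‖f x - f y‖ ≤ ‖x - y‖) (hz : f z = z)
    (hM : ∀ h, Tendsto (fun t : ℝ => t⁻¹ • (f (z + t • h) - f z)) (𝓝[>] 0) (𝓝 (M h)))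
    (hhom : ∀ (t : ℝ) (h : V), 0 ≤ t → M (t • h) = t • M h)
    (hρ₀ : ∀ h, ‖M h‖ ≤ ρ₀ * ‖h‖) (hρ : ρ₀ < ρ) :
    ∃ r > 0, ∀ x, ‖x - z‖ ≤ r → ‖f x - z‖ ≤ ρ * ‖x - z‖ := by
  obtain ⟨r, hr, h⟩ := exists_norm_sub_dirDeriv_le hf hM hhom (sub_pos.2 hρ)
  refine ⟨r, hr, fun x hx => ?_⟩
  have h1 := h (x - z) hx
  rw [add_sub_cancel, hz] at h1
  have h2 := norm_add_le (f x - z - M (x - z)) (M (x - z))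
  rw [sub_add_cancel] at h2
  linarith [hρ₀ (x - z)]

/-- A nonexpansive map that contracts towards a fixed point near it decreases the distance to it
by a fixed amount far from it. -/
theorem norm_sub_le_sub_of_local_contraction {f : V → V} {z : V} {ρ r : ℝ}
    (hf : ∀ x y, ‖f x - f y‖ ≤ ‖x - y‖) (hr : 0 < r)
    (hloc : ∀ x, ‖x - z‖ ≤ r → ‖f x - z‖ ≤ ρ * ‖x - z‖) {x : V} (hx : r ≤ ‖x - z‖) :
    ‖f x - z‖ ≤ ‖x - z‖ - (1 - ρ) * r := by
  have hd : 0 < ‖x - z‖ := hr.trans_le hx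
  set s := r / ‖x - z‖ with hs
  have hs0 : 0 ≤ s := by positivity
  have hs1 : s ≤ 1 := (div_le_one hd).2 hx
  have hsd : s * ‖x - z‖ = r := div_mul_cancel₀ _ hd.ne'
  -- The point of the segment from `z` to `x` at distance `r` from `z`: contraction is applied at
  -- `w`, nonexpansiveness between `w` and `x`.
  set w := z + s • (x - z) with hw
  have hwz : ‖w - z‖ = r := by
    rw [hw, add_sub_cancel_left, norm_smul, Real.norm_of_nonneg hs0, hsd]
  have hxw : ‖x - w‖ = ‖x - z‖ - r := by
    rw [show x - w = (1 - s) • (x - z) by rw [hw]; module, norm_smul,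
      Real.norm_of_nonneg (by linarith), sub_mul, one_mul, hsd]
  have h1 := hloc w hwz.le
  have h2 := norm_add_le (f x - f w) (f w - z)
  rw [sub_add_sub_cancel] at h2
  have h3 := hf x w
  rw [hwz] at h1
  linarith

theorem tendsto_of_local_contraction {f : V → V} {z : V} {ρ r : ℝ}
    (hf : ∀ x y, ‖f x - f y‖ ≤ ‖x - y‖) (hr : 0 < r) (hρ0 : 0 ≤ ρ) (hρ1 : ρ < 1)
    (hloc : ∀ x, ‖x - z‖ ≤ r → ‖f x - z‖ ≤ ρ * ‖x - z‖) {x : ℕ → V}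
    (hx : ∀ k, x (k + 1) = f (x k)) : Tendsto x atTop (𝓝 z) := by
  -- An orbit that stayed outside the ball would lose `(1 - ρ) r` of distance at every step,
  -- forever.
  obtain ⟨K, hK⟩ : ∃ K, ‖x K - z‖ < r := by
    by_contra! hcon
    have hdec : ∀ k : ℕ, ‖x k - z‖ ≤ ‖x 0 - z‖ - k * ((1 - ρ) * r) := by
      intro k
      induction k with
      | zero => simp
      | succ k ih =>
        have := norm_sub_le_sub_of_local_contraction hf hr hloc (hcon k)
        rw [hx]
        push_cast
        linarith
    obtain ⟨k, hk⟩ := Archimedean.arch ‖x 0 - z‖ (mul_pos (sub_pos.2 hρ1) hr)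
    rw [nsmul_eq_mul] at hk
    linarith [hdec k, hcon k]
  have hgeo : ∀ j : ℕ, ‖x (j + K) - z‖ ≤ ρ ^ j * r := by
    intro j
    induction j with
    | zero => simpa using hK.le
    | succ j ih =>
      have hpow : ρ ^ j ≤ 1 := pow_le_one₀ hρ0 hρ1.le
      have := hloc (x (j + K)) (ih.trans (by nlinarith))
      rw [add_right_comm, hx]
      calc _ ≤ _ := this
        _ ≤ ρ * (ρ ^ j * r) := by gcongr
        _ = ρ ^ (j + 1) * r := by ring
  rw [← tendsto_add_atTop_iff_nat K, tendsto_iff_norm_sub_tendsto_zero]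
  refine squeeze_zero (fun _ => norm_nonneg _) hgeo ?_
  simpa using (tendsto_pow_atTop_nhds_zero_of_lt_one hρ0 hρ1).mul_const r

theorem convergence_of_dirDeriv [ProperSpace V] {f M : V → V} {z : V} {ρ₀ : ℝ}
    (hf : ∀ x y, ‖f x - f y‖ ≤ ‖x - y‖) (hz : f z = z)
    (hM : ∀ h, Tendsto (fun t : ℝ => t⁻¹ • (f (z + t • h) - f z)) (𝓝[>] 0) (𝓝 (M h)))
    (hhom : ∀ (t : ℝ) (h : V), 0 ≤ t → M (t • h) = t • M h)
    (hρ₀ : ∀ h, ‖M h‖ ≤ ρ₀ * ‖h‖) (hlt : ρ₀ < 1) {x : ℕ → V} (hx : ∀ k, x (k + 1) = f (x k)) :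
    Tendsto x atTop (𝓝 z) ∧
      ∀ ρ, ρ₀ < ρ → ∃ K : ℕ, ∀ k, K ≤ k → ‖x (k + 1) - z‖ ≤ ρ * ‖x k - z‖ := by
  have hconv : Tendsto x atTop (𝓝 z) := by
    -- The maximum with `0` secures a nonnegative rate, as the geometric decay requires.
    obtain ⟨ρ, hρ, hρ1⟩ := exists_between (max_lt hlt one_pos)
    obtain ⟨r, hr, hloc⟩ := exists_norm_sub_le_mul_of_dirDeriv hf hz hM hhom hρ₀
      ((le_max_left _ _).trans_lt hρ)
    exact tendsto_of_local_contraction hf hr ((le_max_right _ _).trans hρ.le) hρ1 hloc hx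
  refine ⟨hconv, fun ρ hρ => ?_⟩
  obtain ⟨r, hr, hloc⟩ := exists_norm_sub_le_mul_of_dirDeriv hf hz hM hhom hρ₀ hρ
  obtain ⟨K, hK⟩ := eventually_atTop.1
    ((tendsto_iff_norm_sub_tendsto_zero.1 hconv).eventually_lt_const hr)
  refine ⟨K, fun k hk => ?_⟩
  rw [hx]
  exact hloc _ (hK k hk).le

end Nonexpansive

/-! ### The projection onto the range of the adjoint -/

section Range

variable {n m : ℕ} {A : Fin m → Sym (Fin n)}

theorem inner_opAadj (y : Fin m → ℝ) (X : Sym (Fin n)) :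
    inner ℝ (opAadj A y) X = ∑ i, y i * opA A X i := by
  rw [opAadj, Fintype.linearCombination_apply, sum_inner]
  exact Finset.sum_congr rfl fun i _ => real_inner_smul_left (A i) X (y i)

theorem opAadj_injective (hA : Function.Surjective (opA A)) {y : Fin m → ℝ}
    (hy : opAadj A y = 0) : y = 0 := by
  obtain ⟨X, hX⟩ := hA y
  have h := inner_opAadj (A := A) y X
  rw [hy, inner_zero_left, hX] at h
  ext i
  have := (Finset.sum_eq_zero_iff_of_nonneg fun i _ => mul_self_nonneg (y i)).1 h.symm i
    (Finset.mem_univ i)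
  simpa using this

/-- The kernel is trivial because `‖𝒜* y‖² = ⟪y, 𝒜𝒜* y⟫` and `𝒜*` is injective. Hence `Ring.inverse`
is here a true inverse and not its default value `0`. -/
theorem isUnit_gram (hA : Function.Surjective (opA A)) : IsUnit (opA A ∘ₗ opAadj A) := by
  refine (LinearMap.isUnit_iff_ker_eq_bot _).2 (LinearMap.ker_eq_bot'.2 fun y hy => ?_)
  refine opAadj_injective hA ?_
  rw [← inner_self_eq_zero (𝕜 := ℝ), inner_opAadj]
  rw [LinearMap.comp_apply] at hy
  simp [hy]

theorem gramInv_opA_opAadj (hA : Function.Surjective (opA A)) (y : Fin m → ℝ) :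
    gramInv A (opA A (opAadj A y)) = y :=
  LinearMap.congr_fun (Ring.inverse_mul_cancel _ (isUnit_gram hA)) y

theorem opA_opAadj_gramInv (hA : Function.Surjective (opA A)) (y : Fin m → ℝ) :
    opA A (opAadj A (gramInv A y)) = y :=
  LinearMap.congr_fun (Ring.mul_inverse_cancel _ (isUnit_gram hA)) y

theorem projRange_apply (X : Sym (Fin n)) :
    projRange A X = opAadj A (gramInv A (opA A X)) := rfl

theorem projRange_opAadj (hA : Function.Surjective (opA A)) (y : Fin m → ℝ) :
    projRange A (opAadj A y) = opAadj A y := by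
  rw [projRange_apply, gramInv_opA_opAadj hA]

theorem opA_projRange (hA : Function.Surjective (opA A)) (X : Sym (Fin n)) :
    opA A (projRange A X) = opA A X := by
  rw [projRange_apply, opA_opAadj_gramInv hA]

theorem inner_projRange_sub (hA : Function.Surjective (opA A)) (X Y : Sym (Fin n)) :
    inner ℝ (projRange A X) (Y - projRange A Y) = 0 := by
  rw [projRange_apply, inner_opAadj, map_sub, opA_projRange hA, sub_self]
  simp

theorem norm_projRange_add_sq (hA : Function.Surjective (opA A)) (X Y : Sym (Fin n)) :
    ‖projRange A X + (Y - projRange A Y)‖ ^ 2 =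
      ‖projRange A X‖ ^ 2 + ‖Y - projRange A Y‖ ^ 2 := by
  rw [norm_add_sq_real, inner_projRange_sub hA]
  ring

theorem norm_sq_eq_projRange (hA : Function.Surjective (opA A)) (X : Sym (Fin n)) :
    ‖X‖ ^ 2 = ‖projRange A X‖ ^ 2 + ‖X - projRange A X‖ ^ 2 := by
  rw [← norm_projRange_add_sq hA, add_sub_cancel]

/-- If `D` and `H - D` make a nonnegative angle then recombining their projections does not
increase the norm; equality forces `H - D` into the range of `𝒜*` and `D` into the kernel
of `𝒜`. -/
theorem norm_projRange_add_le (hA : Function.Surjective (opA A)) {H D : Sym (Fin n)}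
    (h : 0 ≤ inner ℝ D (H - D)) : ‖projRange A (H - D) + (D - projRange A D)‖ ≤ ‖H‖ := by
  have h1 := norm_projRange_add_sq hA (H - D) D
  have h2 := norm_sq_eq_projRange hA (H - D)
  have h3 := norm_sq_eq_projRange hA D
  have h4 := norm_add_sq_real D (H - D)
  rw [add_sub_cancel] at h4
  refine (pow_le_pow_iff_left₀ (norm_nonneg _) (norm_nonneg _) two_ne_zero).1 ?_
  nlinarith [sq_nonneg ‖projRange A D‖, sq_nonneg ‖H - D - projRange A (H - D)‖]

/-- The gap between the squared norms is exactly `2⟪D, H - D⟫ + ‖𝒫 D‖² + ‖(Id - 𝒫)(H - D)‖²`, a sum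
of nonnegative terms. -/
theorem eq_of_norm_le_norm_projRange_add (hA : Function.Surjective (opA A)) {H D : Sym (Fin n)}
    (h : 0 ≤ inner ℝ D (H - D)) (hle : ‖H‖ ≤ ‖projRange A (H - D) + (D - projRange A D)‖) :
    inner ℝ D (H - D) = 0 ∧ projRange A (H - D) = H - D ∧ projRange A D = 0 := by
  have h1 := norm_projRange_add_sq hA (H - D) D
  have h2 := norm_sq_eq_projRange hA (H - D)
  have h3 := norm_sq_eq_projRange hA D
  have h4 := norm_add_sq_real D (H - D)
  rw [add_sub_cancel] at h4
  have h5 := pow_le_pow_left₀ (norm_nonneg H) hle 2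
  have h6 := sq_nonneg ‖projRange A D‖
  have h7 := sq_nonneg ‖H - D - projRange A (H - D)‖
  refine ⟨by linarith, ?_, ?_⟩
  · rw [eq_comm, ← sub_eq_zero, ← norm_eq_zero]
    exact pow_eq_zero_iff two_ne_zero |>.1 (by linarith)
  · rw [← norm_eq_zero]
    exact pow_eq_zero_iff two_ne_zero |>.1 (by linarith)

theorem continuous_projRange : Continuous (projRange A) :=
  (projRange A).continuous_of_finiteDimensional

end Range

/-! ### Monotonicity of the directional derivative -/

section Monotone

variable {n : ℕ}

theorem blockDeriv_apply (lam : Fin n → ℝ) (G : Sym (Fin n)) (i j : Fin n) :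
    toMat (blockDeriv lam G) i j = derivEntry lam G i j := rfl

theorem derivEntry_of_nonneg_pos {lam : Fin n → ℝ} (G : Sym (Fin n)) {i j : Fin n}
    (hi : 0 ≤ lam i) (hj : 0 < lam j) : derivEntry lam G i j = toMat G i j := by
  rw [derivEntry, dif_neg (fun h => hj.ne' h.2), if_pos ⟨hi, hj.le⟩]

theorem derivEntry_of_neg_pos {lam : Fin n → ℝ} (G : Sym (Fin n)) {i j : Fin n}
    (hi : lam i < 0) (hj : 0 < lam j) :
    derivEntry lam G i j = lam j / (lam j - lam i) * toMat G i j := by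
  rw [derivEntry, dif_neg (fun h => hj.ne' h.2), if_neg (fun h => hi.not_ge h.1),
    if_neg (fun h => hi.not_gt h.1), if_pos ⟨hi, hj⟩]

theorem derivEntry_of_neg_nonpos {lam : Fin n → ℝ} (G : Sym (Fin n)) {i j : Fin n}
    (hi : lam i < 0) (hj : lam j ≤ 0) : derivEntry lam G i j = 0 := by
  rw [derivEntry, dif_neg (fun h => hi.ne h.1), if_neg (fun h => hi.not_ge h.1),
    if_neg (fun h => hi.not_gt h.1), if_neg (fun h => hj.not_gt h.2)]

theorem derivEntry_of_zero_zero {lam : Fin n → ℝ} (G : Sym (Fin n)) {i j : Fin n}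
    (hi : lam i = 0) (hj : lam j = 0) :
    derivEntry lam G i j = toMat (psdProj (zeroBlock lam G)) ⟨i, hi⟩ ⟨j, hj⟩ := by
  rw [derivEntry, dif_pos ⟨hi, hj⟩]

/-- Outside `ββ` the derivative multiplies each entry `g` by some `θ ∈ [0, 1]`, so the product is
`θ(1 - θ)g²`. -/
theorem derivEntry_mul_nonneg {lam : Fin n → ℝ} (G : Sym (Fin n)) {i j : Fin n}
    (h : ¬(lam i = 0 ∧ lam j = 0)) :
    0 ≤ derivEntry lam G i j * (toMat G i j - derivEntry lam G i j) := by
  have key : ∀ {i j : Fin n}, lam i < 0 → 0 < lam j →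
      0 ≤ derivEntry lam G i j * (toMat G i j - derivEntry lam G i j) := by
    intro i j hi hj
    have hd : 0 < lam j - lam i := by linarith
    rw [derivEntry_of_neg_pos G hi hj,
      show lam j / (lam j - lam i) * toMat G i j *
        (toMat G i j - lam j / (lam j - lam i) * toMat G i j) =
        lam j * -lam i / (lam j - lam i) ^ 2 * toMat G i j ^ 2 by field_simp; ring]
    have : 0 < -lam i := by linarith
    positivity
  rcases lt_trichotomy (lam i) 0 with hi | hi | hi <;>
    rcases lt_trichotomy (lam j) 0 with hj | hj | hj
  · rw [derivEntry_of_neg_nonpos G hi hj.le, zero_mul]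
  · rw [derivEntry_of_neg_nonpos G hi hj.le, zero_mul]
  · exact key hi hj
  · rw [derivEntry_symm, derivEntry_of_neg_nonpos G hj hi.le, zero_mul]
  · exact absurd ⟨hi, hj⟩ h
  · rw [derivEntry_of_nonneg_pos G hi.ge hj, sub_self, mul_zero]
  · rw [derivEntry_symm, toMat_apply_comm]
    exact key hj hi
  · rw [derivEntry_symm, derivEntry_of_nonneg_pos G hj.ge hi, toMat_apply_comm, sub_self, mul_zero]
  · rw [derivEntry_of_nonneg_pos G hi.le hj, sub_self, mul_zero]

theorem zeroBlock_blockDeriv (lam : Fin n → ℝ) (G : Sym (Fin n)) :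
    zeroBlock lam (blockDeriv lam G) = psdProj (zeroBlock lam G) := by
  apply toMat_injective
  ext i j
  exact derivEntry_of_zero_zero G i.2 j.2

-- Entries of the block `ββ` have no individual sign, but their total contribution vanishes by
-- Moreau's orthogonality; it can be dropped from the sum.
open Classical in
theorem inner_blockDeriv_sub (lam : Fin n → ℝ) (G : Sym (Fin n)) :
    inner ℝ (blockDeriv lam G) (G - blockDeriv lam G) =
      ∑ i, ∑ j, if lam i = 0 ∧ lam j = 0 then 0
        else derivEntry lam G i j * (toMat G i j - derivEntry lam G i j) := by
  have h0 : inner ℝ (extendZeroBlock lam (psdProj (zeroBlock lam G))) (G - blockDeriv lam G) =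
      0 := by
    rw [inner_extendZeroBlock]
    have : zeroBlock lam (G - blockDeriv lam G) = zeroBlock lam G - psdProj (zeroBlock lam G) := by
      rw [← zeroBlock_blockDeriv]
      rfl
    rw [this, real_inner_comm, inner_sub_psdProj_self]
  refine (sub_eq_self.2 h0).symm.trans ?_
  rw [inner_eq_sum, inner_eq_sum, ← Finset.sum_sub_distrib]
  refine Finset.sum_congr rfl fun i _ => ?_
  rw [← Finset.sum_sub_distrib]
  refine Finset.sum_congr rfl fun j _ => ?_
  rw [toMat_sub, Matrix.sub_apply, blockDeriv_apply, extendZeroBlock, toMat_ofMat, Matrix.of_apply]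
  by_cases h : lam i = 0 ∧ lam j = 0
  · rw [if_pos h, dif_pos h, derivEntry_of_zero_zero G h.1 h.2, sub_self]
  · rw [if_neg h, dif_neg h, zero_mul, sub_zero]

theorem inner_blockDeriv_sub_nonneg (lam : Fin n → ℝ) (G : Sym (Fin n)) :
    0 ≤ inner ℝ (blockDeriv lam G) (G - blockDeriv lam G) := by
  rw [inner_blockDeriv_sub]
  refine Finset.sum_nonneg fun i _ => Finset.sum_nonneg fun j _ => ?_
  split_ifs with h
  · exact le_rfl
  · exact derivEntry_mul_nonneg G h

/-- On `γ × α` the multiplier lies strictly between `0` and `1`, so a vanishing term forces a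
vanishing entry. -/
theorem eq_zero_of_inner_blockDeriv_sub_eq_zero {lam : Fin n → ℝ} {G : Sym (Fin n)}
    (h : inner ℝ (blockDeriv lam G) (G - blockDeriv lam G) = 0) {i j : Fin n}
    (hi : lam i < 0) (hj : 0 < lam j) : toMat G i j = 0 := by
  classical
  rw [inner_blockDeriv_sub] at h
  have hnn : ∀ i j, 0 ≤ if lam i = 0 ∧ lam j = 0 then 0
      else derivEntry lam G i j * (toMat G i j - derivEntry lam G i j) := fun i j => by
    split_ifs with h
    · exact le_rfl
    · exact derivEntry_mul_nonneg G h
  have h1 := (Finset.sum_eq_zero_iff_of_nonneg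
    fun i _ => Finset.sum_nonneg fun j _ => hnn i j).1 h i (Finset.mem_univ i)
  have h2 := (Finset.sum_eq_zero_iff_of_nonneg fun j _ => hnn i j).1 h1 j (Finset.mem_univ j)
  rw [if_neg (fun h => hi.ne h.1), derivEntry_of_neg_pos G hi hj] at h2
  have hd : lam j - lam i ≠ 0 := by linarith
  rcases mul_eq_zero.1 h2 with h3 | h3
  · exact (mul_eq_zero.1 h3).resolve_left (div_ne_zero hj.ne' hd)
  · rw [show toMat G i j - lam j / (lam j - lam i) * toMat G i j =
      -lam i / (lam j - lam i) * toMat G i j by field_simp; ring] at h3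
    exact (mul_eq_zero.1 h3).resolve_left (div_ne_zero (by linarith) hd)

theorem blockDeriv_smul (lam : Fin n → ℝ) {t : ℝ} (ht : 0 ≤ t) (G : Sym (Fin n)) :
    blockDeriv lam (t • G) = t • blockDeriv lam G := by
  apply toMat_injective
  ext i j
  have hz : zeroBlock lam (t • G) = t • zeroBlock lam G := rfl
  rw [toMat_smul, Matrix.smul_apply, blockDeriv_apply, blockDeriv_apply, smul_eq_mul]
  unfold derivEntry
  rw [hz, psdProj_smul ht]
  simp only [toMat_smul, Matrix.smul_apply, smul_eq_mul]
  split_ifs <;> ring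

end Monotone

/-! ### Nondegeneracy -/

section Nondegenerate

variable {n m : ℕ} {A : Fin m → Sym (Fin n)} {Q : Matrix (Fin n) (Fin n) ℝ} {lam : Fin n → ℝ}

theorem inner_dirDeriv (hQ : Q ∈ Matrix.orthogonalGroup (Fin n) ℝ) (H K : Sym (Fin n)) :
    inner ℝ (dirDeriv Q lam H) K =
      inner ℝ (blockDeriv lam (conj Q.transpose H)) (conj Q.transpose K) := by
  rw [dirDeriv_eq, ← inner_conj hQ (blockDeriv lam _) (conj Q.transpose K), conj_conj_transpose hQ]

theorem conj_transpose_dirDeriv (hQ : Q ∈ Matrix.orthogonalGroup (Fin n) ℝ) (H : Sym (Fin n)) :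
    conj Q.transpose (dirDeriv Q lam H) = blockDeriv lam (conj Q.transpose H) := by
  rw [dirDeriv_eq, conj_transpose_conj hQ]

theorem inner_dirDeriv_sub (hQ : Q ∈ Matrix.orthogonalGroup (Fin n) ℝ) (H : Sym (Fin n)) :
    inner ℝ (dirDeriv Q lam H) (H - dirDeriv Q lam H) =
      inner ℝ (blockDeriv lam (conj Q.transpose H))
        (conj Q.transpose H - blockDeriv lam (conj Q.transpose H)) := by
  rw [inner_dirDeriv hQ, conj_sub, conj_transpose_dirDeriv hQ]

theorem inner_dirDeriv_sub_nonneg (hQ : Q ∈ Matrix.orthogonalGroup (Fin n) ℝ) (H : Sym (Fin n)) :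
    0 ≤ inner ℝ (dirDeriv Q lam H) (H - dirDeriv Q lam H) := by
  rw [inner_dirDeriv_sub hQ]
  exact inner_blockDeriv_sub_nonneg lam _

theorem dirDeriv_smul (Q : Matrix (Fin n) (Fin n) ℝ) (lam : Fin n → ℝ) {t : ℝ} (ht : 0 ≤ t)
    (H : Sym (Fin n)) : dirDeriv Q lam (t • H) = t • dirDeriv Q lam H := by
  rw [dirDeriv_eq, conj_smul, blockDeriv_smul lam ht, conj_smul, dirDeriv_eq]

theorem derivEntry_eq_zero {G : Sym (Fin n)} (hG : ∀ i j, lam i < 0 → 0 < lam j → toMat G i j = 0)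
    {i j : Fin n} (hi : lam i < 0) : derivEntry lam G i j = 0 := by
  rcases lt_or_ge 0 (lam j) with hj | hj
  · rw [derivEntry_of_neg_pos G hi hj, hG i j hi hj, mul_zero]
  · exact derivEntry_of_neg_nonpos G hi hj

theorem derivEntry_eq_self {G : Sym (Fin n)} (hG : ∀ i j, lam i < 0 → 0 < lam j → toMat G i j = 0)
    {i j : Fin n} (hj : 0 < lam j) : derivEntry lam G i j = toMat G i j := by
  rcases lt_or_ge (lam i) 0 with hi | hi
  · rw [derivEntry_of_neg_pos G hi hj, hG i j hi hj, mul_zero]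
  · exact derivEntry_of_nonneg_pos G hi hj

/-- Once `G_γα = 0`, the rows and columns of `D` in `γ` vanish, while `K` vanishes wherever both
indices lie outside `γ`: the supports are disjoint. -/
theorem inner_dirDeriv_tangentS (hQ : Q ∈ Matrix.orthogonalGroup (Fin n) ℝ) {H K : Sym (Fin n)}
    (h : inner ℝ (dirDeriv Q lam H) (H - dirDeriv Q lam H) = 0) (hK : K ∈ tangentS Q lam) :
    inner ℝ (dirDeriv Q lam H) K = 0 := by
  rw [inner_dirDeriv_sub hQ] at h
  have hG := fun i j => eq_zero_of_inner_blockDeriv_sub_eq_zero (i := i) (j := j) h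
  rw [inner_dirDeriv hQ, inner_eq_sum]
  refine Finset.sum_eq_zero fun i _ => Finset.sum_eq_zero fun j _ => ?_
  rw [blockDeriv_apply]
  rcases lt_or_ge (lam i) 0 with hi | hi
  · rw [derivEntry_eq_zero hG hi, zero_mul]
  rcases lt_or_ge (lam j) 0 with hj | hj
  · rw [derivEntry_symm, derivEntry_eq_zero hG hj, zero_mul]
  · rw [hK i j (neg_nonpos.2 hi) (neg_nonpos.2 hj), mul_zero]

/-- The mirror image: `D` agrees with `G` on the rows and columns in `α`, so `G - D` lives where `K`
is zero. -/
theorem inner_sub_dirDeriv_tangentX (hQ : Q ∈ Matrix.orthogonalGroup (Fin n) ℝ)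
    {H K : Sym (Fin n)} (h : inner ℝ (dirDeriv Q lam H) (H - dirDeriv Q lam H) = 0)
    (hK : K ∈ tangentX Q lam) : inner ℝ (H - dirDeriv Q lam H) K = 0 := by
  rw [inner_dirDeriv_sub hQ] at h
  have hG := fun i j => eq_zero_of_inner_blockDeriv_sub_eq_zero (i := i) (j := j) h
  rw [← conj_conj_transpose hQ (H - dirDeriv Q lam H), ← conj_conj_transpose hQ K, inner_conj hQ,
    conj_sub, conj_transpose_dirDeriv hQ, inner_eq_sum]
  refine Finset.sum_eq_zero fun i _ => Finset.sum_eq_zero fun j _ => ?_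
  rw [toMat_sub, Matrix.sub_apply, blockDeriv_apply]
  rcases lt_or_ge 0 (lam j) with hj | hj
  · rw [derivEntry_eq_self hG hj, sub_self, zero_mul]
  rcases lt_or_ge 0 (lam i) with hi | hi
  · rw [derivEntry_symm, derivEntry_eq_self hG hi, toMat_apply_comm, sub_self, zero_mul]
  · rw [hK i j hi hj, mul_zero]

theorem opM_smul (A : Fin m → Sym (Fin n)) (Q : Matrix (Fin n) (Fin n) ℝ) (lam : Fin n → ℝ)
    {t : ℝ} (ht : 0 ≤ t) (H : Sym (Fin n)) : opM A Q lam (t • H) = t • opM A Q lam H := by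
  rw [opM, opM, dirDeriv_smul Q lam ht, ← smul_sub, map_smul, map_smul, ← smul_sub, ← smul_add]

theorem norm_opM_le (hA : Function.Surjective (opA A)) (hQ : Q ∈ Matrix.orthogonalGroup (Fin n) ℝ)
    (H : Sym (Fin n)) : ‖opM A Q lam H‖ ≤ ‖H‖ :=
  norm_projRange_add_le hA (inner_dirDeriv_sub_nonneg hQ H)

theorem eq_zero_of_norm_le_norm_opM (hA : Function.Surjective (opA A))
    (hQ : Q ∈ Matrix.orthogonalGroup (Fin n) ℝ) (hP : PrimalNondegenerate A Q lam)
    (hD : DualNondegenerate A Q lam) {H : Sym (Fin n)} (h : ‖H‖ ≤ ‖opM A Q lam H‖) : H = 0 := by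
  obtain ⟨h0, h1, h2⟩ :=
    eq_of_norm_le_norm_projRange_add hA (inner_dirDeriv_sub_nonneg (lam := lam) hQ H) h
  set D := dirDeriv Q lam H with hDdef
  have hAD : opA A D = 0 := by rw [← opA_projRange hA, h2, map_zero]
  -- Dual nondegeneracy splits `D` into a part in `𝒯_S` and a part in the range of `𝒜*`. Both are
  -- orthogonal to `D`, the second because `𝒜 D = 0`.
  have hD0 : D = 0 := by
    have htop : D ∈ tangentS Q lam ⊔ LinearMap.range (opAadj A) := by
      rw [hD]
      exact Submodule.mem_top
    obtain ⟨K, hK, _, ⟨y, rfl⟩, hKy⟩ := Submodule.mem_sup.1 htop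
    rw [← inner_self_eq_zero (𝕜 := ℝ)]
    nth_rewrite 2 [← hKy]
    rw [inner_add_right, inner_dirDeriv_tangentS hQ h0 hK, real_inner_comm, inner_opAadj, hAD]
    simp
  have hE0 : H - D = 0 := by
    have htop : H - D ∈ tangentX Q lam ⊔ LinearMap.ker (opA A) := by
      rw [hP]
      exact Submodule.mem_top
    obtain ⟨K, hK, W, hW, hKW⟩ := Submodule.mem_sup.1 htop
    rw [← inner_self_eq_zero (𝕜 := ℝ)]
    nth_rewrite 2 [← hKW]
    rw [inner_add_right, inner_sub_dirDeriv_tangentX hQ h0 hK, ← h1, projRange_apply, inner_opAadj,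
      LinearMap.mem_ker.1 hW]
    simp
  rw [← sub_add_cancel H D, hE0, hD0, add_zero]

theorem bddAbove_normValues (hA : Function.Surjective (opA A))
    (hQ : Q ∈ Matrix.orthogonalGroup (Fin n) ℝ) : BddAbove (normValues A Q lam) := by
  refine ⟨1, ?_⟩
  rintro _ ⟨H, hH, rfl⟩
  exact (norm_opM_le hA hQ H).trans_eq hH

theorem norm_opM_le_rhoND (hA : Function.Surjective (opA A))
    (hQ : Q ∈ Matrix.orthogonalGroup (Fin n) ℝ) (H : Sym (Fin n)) :
    ‖opM A Q lam H‖ ≤ rhoND A Q lam * ‖H‖ := by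
  by_cases h0 : H = 0
  · have := norm_opM_le (lam := lam) hA hQ H
    rw [h0, norm_zero] at this
    rw [h0, norm_zero, mul_zero]
    exact this
  have hH : 0 < ‖H‖ := norm_pos_iff.2 h0
  have h1 : ‖opM A Q lam (‖H‖⁻¹ • H)‖ ≤ rhoND A Q lam := by
    refine le_csSup (bddAbove_normValues hA hQ) ⟨‖H‖⁻¹ • H, ?_, rfl⟩
    rw [norm_smul, norm_inv, norm_norm, inv_mul_cancel₀ hH.ne']
  rwa [opM_smul A Q lam (inv_nonneg.2 hH.le), norm_smul, norm_inv, norm_norm,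
    inv_mul_le_iff₀ hH, mul_comm] at h1

theorem rhoND_lt_one (hA : Function.Surjective (opA A))
    (hQ : Q ∈ Matrix.orthogonalGroup (Fin n) ℝ) (hP : PrimalNondegenerate A Q lam)
    (hD : DualNondegenerate A Q lam) (hcont : Continuous (opM A Q lam)) :
    rhoND A Q lam < 1 := by
  have himg : normValues A Q lam =
      (fun H => ‖opM A Q lam H‖) '' Metric.sphere (0 : Sym (Fin n)) 1 := by
    ext c
    constructor
    · rintro ⟨H, hH, rfl⟩
      exact ⟨H, mem_sphere_zero_iff_norm.2 hH, rfl⟩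
    · rintro ⟨H, hH, rfl⟩
      exact ⟨H, mem_sphere_zero_iff_norm.1 hH, rfl⟩
  rcases (normValues A Q lam).eq_empty_or_nonempty with he | hne
  -- An empty sphere occurs for `n = 0`; the supremum then has the default value `0`.
  · rw [rhoND, he, Real.sSup_empty]
    exact one_pos
  have hcomp : IsCompact (normValues A Q lam) := by
    rw [himg]
    exact (isCompact_sphere _ _).image hcont.norm
  obtain ⟨H, hH, hc⟩ := hcomp.sSup_mem hne
  rw [rhoND, hc]
  by_contra! hcon
  have := eq_zero_of_norm_le_norm_opM hA hQ hP hD (hH.trans_le hcon)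
  rw [this, norm_zero] at hH
  exact zero_ne_one hH

end Nondegenerate

/-! ### One-step and three-step ADMM -/

section ADMM

variable {n m : ℕ} {A : Fin m → Sym (Fin n)} {b : Fin m → ℝ} {C : Sym (Fin n)} {σ : ℝ}

/-- The data `b`, `C`, `σ` cancel, leaving the form of `opM` with increments of `Π` in place of its
derivative; one norm estimate serves both. -/
theorem oneStep_sub_oneStep (W Z : Sym (Fin n)) :
    oneStep A b C σ W - oneStep A b C σ Z =
      projRange A ((W - Z) - (psdProj W - psdProj Z)) +
        ((psdProj W - psdProj Z) - projRange A (psdProj W - psdProj Z)) := by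
  simp only [oneStep, ← projRange_apply, map_add, map_sub, map_smul]
  module

theorem norm_oneStep_sub_le (hA : Function.Surjective (opA A)) (W Z : Sym (Fin n)) :
    ‖oneStep A b C σ W - oneStep A b C σ Z‖ ≤ ‖W - Z‖ := by
  rw [oneStep_sub_oneStep]
  exact norm_projRange_add_le hA (inner_psdProj_sub_nonneg W Z)

theorem tendsto_oneStep_opM {Q : Matrix (Fin n) (Fin n) ℝ}
    (hQ : Q ∈ Matrix.orthogonalGroup (Fin n) ℝ) {lam : Fin n → ℝ} {Z : Sym (Fin n)}
    (hZ : toMat Z = Q * Matrix.diagonal lam * Q.transpose) (H : Sym (Fin n)) :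
    Tendsto (fun t : ℝ => t⁻¹ • (oneStep A b C σ (Z + t • H) - oneStep A b C σ Z)) (𝓝[>] 0)
      (𝓝 (opM A Q lam H)) := by
  have hD := tendsto_psdProj_dirDeriv hQ hZ H
  have hcont : Continuous fun D : Sym (Fin n) =>
      projRange A (H - D) + (D - projRange A D) := by
    have := continuous_projRange (A := A)
    fun_prop
  refine ((hcont.tendsto _).comp hD).congr' ?_
  filter_upwards [self_mem_nhdsWithin] with t ht
  have ht0 : t ≠ 0 := (show (0 : ℝ) < t from ht).ne'
  rw [oneStep_sub_oneStep, Function.comp_apply, add_sub_cancel_left]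
  generalize psdProj (Z + t • H) - psdProj Z = Δ
  simp only [map_sub, map_smul, smul_add, smul_sub, inv_smul_smul₀ ht0]

theorem psdProj_sub_smul_eq (hσ : 0 < σ) {X S : Sym (Fin n)} (hX : X ∈ psdCone (Fin n))
    (hS : S ∈ psdCone (Fin n)) (h : inner ℝ X S = 0) : psdProj (X - σ • S) = X :=
  psdProj_sub_eq hX (psd_smul hσ.le hS)
    ((real_inner_smul_right X S σ).trans (by rw [h, mul_zero]))

theorem oneStep_kkt (hσ : 0 < σ) (hA : Function.Surjective (opA A)) {X S : Sym (Fin n)}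
    {y : Fin m → ℝ} (h : IsKKT A b C X y S) : oneStep A b C σ (X - σ • S) = X - σ • S := by
  have hC : projRange A C = opAadj A y + projRange A S := by
    rw [← h.dual_feasible, map_add, projRange_opAadj hA]
  rw [oneStep, psdProj_sub_smul_eq hσ h.primal_psd h.dual_psd h.complementary]
  simp only [← h.primal_feasible, ← projRange_apply, hC, map_add, map_sub, map_smul]
  rw [← h.dual_feasible]
  module

/-- The `S`-step projects some `W`, and the `X`-step makes `Z = -σW`. Thus `X` and `σS` are the
Moreau parts of `Z`, so the three-step iterates can be recovered from `Z` alone. -/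
theorem IsADMM.psdProj_eq (hσ : 0 < σ) {X S : ℕ → Sym (Fin n)} {y : ℕ → Fin m → ℝ}
    (h : IsADMM A b C σ X y S) (k : ℕ) :
    X (k + 1) - σ • S (k + 1) = X k + σ • (opAadj A (y (k + 1)) - C) ∧
      psdProj (X (k + 1) - σ • S (k + 1)) = X (k + 1) := by
  set W := C - opAadj A (y (k + 1)) - σ⁻¹ • X k with hW
  have hσW : σ • W = -(X k + σ • (opAadj A (y (k + 1)) - C)) := by
    rw [hW, smul_sub, smul_inv_smul₀ hσ.ne']
    module
  have h1 : X (k + 1) - σ • S (k + 1) = X k + σ • (opAadj A (y (k + 1)) - C) := by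
    rw [h.X_step]
    module
  refine ⟨h1, ?_⟩
  have h2 : psdProj (-(σ • W)) = σ • S (k + 1) - σ • W := by
    rw [psdProj_neg, psdProj_smul hσ.le, h.S_step]
  rw [h1, ← neg_neg (X k + _), ← hσW, h2, hσW, h.X_step]
  module

theorem IsADMM.oneStep_eq (hσ : 0 < σ) {X S : ℕ → Sym (Fin n)} {y : ℕ → Fin m → ℝ}
    (h : IsADMM A b C σ X y S) (k : ℕ) :
    X (k + 1 + 1) - σ • S (k + 1 + 1) = oneStep A b C σ (X (k + 1) - σ • S (k + 1)) := by
  rw [(h.psdProj_eq hσ (k + 1)).1, oneStep, (h.psdProj_eq hσ k).2, h.y_step]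
  simp only [← projRange_apply, map_add, map_sub, map_smul, smul_sub, smul_add, smul_smul,
    mul_inv_cancel₀ hσ.ne', one_smul]
  module

end ADMM

end SDPADMM

theorem mainTheorem4 {n m : ℕ} (A : Fin m → SDPADMM.Sym (Fin n)) (b : Fin m → ℝ)
    (C : SDPADMM.Sym (Fin n)) (σ : ℝ) (hσ : 0 < σ)
    (hA : Function.Surjective (SDPADMM.opA A))
    (Xs : SDPADMM.Sym (Fin n)) (ys : Fin m → ℝ) (Ss : SDPADMM.Sym (Fin n))
    (hKKT : SDPADMM.IsKKT A b C Xs ys Ss)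
    (Q : Matrix (Fin n) (Fin n) ℝ) (hQ : Q ∈ Matrix.orthogonalGroup (Fin n) ℝ)
    (lam : Fin n → ℝ)
    (hZ : SDPADMM.toMat (Xs - σ • Ss) = Q * Matrix.diagonal lam * Q.transpose)
    (hP : SDPADMM.PrimalNondegenerate A Q lam)
    (hD : SDPADMM.DualNondegenerate A Q lam) :
    (∀ H : SDPADMM.Sym (Fin n),
      Tendsto
        (fun t : ℝ => t⁻¹ • (SDPADMM.psdProj (Xs - σ • Ss + t • H)
          - SDPADMM.psdProj (Xs - σ • Ss)))
        (𝓝[>] 0) (𝓝 (SDPADMM.dirDeriv Q lam H))) ∧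
    (∀ (t : ℝ) (H : SDPADMM.Sym (Fin n)), 0 ≤ t →
      SDPADMM.opM A Q lam (t • H) = t • SDPADMM.opM A Q lam H) ∧
    BddAbove (SDPADMM.normValues A Q lam) ∧
    SDPADMM.rhoND A Q lam < 1 ∧
    (∀ Z : ℕ → SDPADMM.Sym (Fin n),
      (∀ k, Z (k + 1) = SDPADMM.oneStep A b C σ (Z k)) →
      SDPADMM.ConvergesQLinearly Z (Xs - σ • Ss) (SDPADMM.rhoND A Q lam)) ∧
    (∀ (X : ℕ → SDPADMM.Sym (Fin n)) (y : ℕ → Fin m → ℝ) (S : ℕ → SDPADMM.Sym (Fin n)),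
      SDPADMM.IsADMM A b C σ X y S →
      SDPADMM.ConvergesQLinearly (fun k => X k - σ • S k) (Xs - σ • Ss)
        (SDPADMM.rhoND A Q lam)) := by
  have hnonexp := SDPADMM.norm_oneStep_sub_le (b := b) (C := C) (σ := σ) hA
  have hfix := SDPADMM.oneStep_kkt hσ hA hKKT
  have hder := SDPADMM.tendsto_oneStep_opM (A := A) (b := b) (C := C) (σ := σ) hQ hZ
  have hhom : ∀ (t : ℝ) (H : SDPADMM.Sym (Fin n)), 0 ≤ t →
      SDPADMM.opM A Q lam (t • H) = t • SDPADMM.opM A Q lam H :=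
    fun t H ht => SDPADMM.opM_smul A Q lam ht H
  -- `ℳ̃` is the directional derivative of a nonexpansive map, hence itself 1-Lipschitz.
  have hcont : Continuous (SDPADMM.opM A Q lam) :=
    (LipschitzWith.of_dist_le_mul (K := 1) fun H K => by
      simpa [dist_eq_norm] using SDPADMM.norm_dirDeriv_sub_le hnonexp hder H K).continuous
  have hlt := SDPADMM.rhoND_lt_one hA hQ hP hD hcont
  have hone : ∀ Z : ℕ → SDPADMM.Sym (Fin n),
      (∀ k, Z (k + 1) = SDPADMM.oneStep A b C σ (Z k)) →
      SDPADMM.ConvergesQLinearly Z (Xs - σ • Ss) (SDPADMM.rhoND A Q lam) := by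
    intro Z hZk
    obtain ⟨h1, h2⟩ := SDPADMM.convergence_of_dirDeriv hnonexp hfix hder hhom
      (SDPADMM.norm_opM_le_rhoND hA hQ) hlt hZk
    exact ⟨h1, fun ρ hρ _ => h2 ρ hρ⟩
  refine ⟨SDPADMM.tendsto_psdProj_dirDeriv hQ hZ, hhom, SDPADMM.bddAbove_normValues hA hQ, hlt,
    hone, fun X y S h => ?_⟩
  obtain ⟨h1, h2⟩ := hone (fun k => X (k + 1) - σ • S (k + 1)) (h.oneStep_eq hσ)
  -- The starting pair need not be a Moreau pair, so the one-step recursion is available only from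
  -- index `1` on; hence the shift.
  refine ⟨(tendsto_add_atTop_iff_nat 1).1 h1, fun ρ hρ hρ1 => ?_⟩
  obtain ⟨K, hK⟩ := h2 ρ hρ hρ1
  refine ⟨K + 1, fun k hk => ?_⟩
  obtain ⟨j, rfl⟩ : ∃ j, k = j + 1 := ⟨k - 1, by omega⟩
  exact hK j (by omega)
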